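/- For a set $A$ of positive integers let $p_A(n)$ denote the number of partitions of $n$ all of whose parts lie in $A$, let $p(n)$ denote the number of all partitions of $n$, and let the lower density of $A$ be $\liminf_{n\to\infty}|A\cap\{1,\dots,n\}|/n$. Write $\log$ for the natural logarithm, with $\log 0=-\infty$, and let $o_\alpha(1)$ denote a quantity that depends only on $\alpha$ and tends to $0$ as $\alpha\to 0^+$. For every $0<\alpha<1$ there is a set $A$ of positive integers of lower density $\alpha$ with $\gcd(A)=1$ satisfying $$\liminf_{n\to\infty}\frac{\log p_A(n)}{\log p(\lfloor\alpha n\rfloor)}\ \ge\ (1-o_\alpha(1))\,\frac{\sqrt6}{\pi}\,\log(1/\alpha).$$ Furthermore, this lower bound is best possible: for every $0<\alpha<1$, every set $A$ of positive integers of lower density $\alpha$ satisfies $$\liminf_{n\to\infty}\frac{\log p_A(n)}{\log p(\lfloor\alpha n\rfloor)}\ \le\ (1+o_\alpha(1))\,\frac{\sqrt6}{\pi}\,\log(1/\alpha).$$ -/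

import Mathlib

open Filter Topology
open scoped ENNReal

noncomputable section

/-- `p(n)`: the number of partitions of `n`. -/
def partitionCount (n : ℕ) : ℕ :=
  Nat.card (Nat.Partition n)

/-- `p_A(n)`: the number of partitions of `n` all of whose parts lie in `A`. -/
def restrictedPartitionCount (A : Set ℕ) (n : ℕ) : ℕ :=
  Nat.card {P : Nat.Partition n // ∀ i ∈ P.parts, i ∈ A}

/-- The lower (asymptotic) density `liminf |A ∩ {1, …, n}| / n`. The sequence takes values in
`[0, 1]`, so the real-valued lower limit is the genuine one. -/
def lowerDensity (A : Set ℕ) : ℝ :=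
  liminf (fun n : ℕ => ((A ∩ Set.Icc 1 n).ncard : ℝ) / (n : ℝ)) atTop

/-- The lower limit of `log p_A(n) / log p(⌊α n⌋)` as `n → ∞`, in the extended reals, with
`log 0 = -∞`. The denominator is a positive real number as soon as `⌊α n⌋ ≥ 2`. -/
def liminfLogRatio (A : Set ℕ) (α : ℝ) : EReal :=
  liminf (fun n : ℕ =>
    ENNReal.log (restrictedPartitionCount A n : ℝ≥0∞) /
      ((Real.log (partitionCount ⌊α * (n : ℝ)⌋₊ : ℝ) : ℝ) : EReal)) atTop

end

/-! The upper bound evaluates the generating function `∏ (1 - x ^ a)⁻¹` at `x = e ^ (-s)` with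
`s = (log (1 / α) + 1) / N`, where `A` has about `α N` elements up to `N` and `n` is about
`α N ^ 2`. The extremal set consists of the blocks `(j!, α (j + 1)!]`. For `n = α X ^ 2`, the small
parts in `(θ α N, α N]` and the large parts in `(N, (1 + θ) N]` contribute about
`α N log (1 / α)` and `(n / N) log (1 / α)` to `log p_A(n)`. If `X` is near a factorial, both kinds
of parts are available with `N` that factorial, and `α N + n / N ≥ 2 α X` by the inequality between
the arithmetic and geometric means; if `X` is far from all factorials, then one kind alone, with
`N = 2 X` or `N = X / 2`, yields `2 α X log (1 / α)`. These bounds are compared with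
`log p(n) ~ π √(2 n / 3)`, which follows from a Tauberian argument for the generating function. -/

/-! ### Generating functions of restricted partitions -/

section GeneratingFunction

open Finset PowerSeries
open scoped PowerSeries.WithPiTopology

lemma hasSum_coeff_mul_mul_pow {f g : ℝ⟦X⟧} {x u v : ℝ} (hf : HasSum (fun n ↦ coeff n f * x ^ n) u)
    (hg : HasSum (fun n ↦ coeff n g * x ^ n) v) :
    HasSum (fun n ↦ coeff n (f * g) * x ^ n) (u * v) := by
  have hcoeff (n : ℕ) : coeff n (f * g) * x ^ n =
      ∑ kl ∈ antidiagonal n, coeff kl.1 f * x ^ kl.1 * (coeff kl.2 g * x ^ kl.2) := by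
    rw [coeff_mul, sum_mul]
    refine sum_congr rfl fun kl hkl ↦ ?_
    rw [← mem_antidiagonal.1 hkl, pow_add]
    ring
  simp only [hcoeff, ← hf.tsum_eq, ← hg.tsum_eq]
  rw [tsum_mul_tsum_eq_tsum_sum_antidiagonal_of_summable_norm hf.summable.norm hg.summable.norm]
  exact (summable_norm_sum_mul_antidiagonal_of_summable_norm
    hf.summable.norm hg.summable.norm).of_norm.hasSum

lemma hasSum_coeff_prod_mul_pow {ι : Type*} (B : Finset ι) {f : ι → ℝ⟦X⟧} {x : ℝ} {u : ι → ℝ}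
    (h : ∀ i ∈ B, HasSum (fun n ↦ coeff n (f i) * x ^ n) (u i)) :
    HasSum (fun n ↦ coeff n (∏ i ∈ B, f i) * x ^ n) (∏ i ∈ B, u i) := by
  classical
  induction B using Finset.induction_on with
  | empty =>
    convert! hasSum_ite_eq 0 (1 : ℝ) using 2 with n
    split_ifs with hn <;> simp [coeff_one, hn]
  | insert i B hi ih =>
    rw [prod_insert hi, prod_insert hi]
    exact hasSum_coeff_mul_mul_pow (h i (mem_insert_self i B))
      (ih fun j hj ↦ h j (mem_insert_of_mem hj))

lemma hasSum_coeff_geometric_mul_pow {a : ℕ} (ha : a ≠ 0) {x : ℝ} (hx₀ : 0 ≤ x) (hx₁ : x < 1) :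
    HasSum (fun n ↦ coeff n (∑' j : ℕ, X ^ (a * j) : ℝ⟦X⟧) * x ^ n) (1 - x ^ a)⁻¹ := by
  have hsummable : Summable fun j : ℕ ↦ (X ^ (a * j) : ℝ⟦X⟧) := by
    simp_rw [pow_mul]
    exact WithPiTopology.summable_pow_of_constantCoeff_eq_zero (by simp [ha])
  have hinj : Function.Injective fun j : ℕ ↦ a * j := mul_right_injective₀ ha
  have hcoeff (n : ℕ) : coeff n (∑' j : ℕ, X ^ (a * j) : ℝ⟦X⟧) =
      if a ∣ n then 1 else 0 := by
    rw [hsummable.map_tsum _ (WithPiTopology.continuous_coeff _ n)]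
    simp only [coeff_X_pow]
    split_ifs with hn
    · obtain ⟨j, rfl⟩ := hn
      rw [tsum_eq_single j fun i hi ↦ if_neg fun h ↦ hi (hinj h).symm, if_pos rfl]
    · exact (tsum_congr fun j ↦ if_neg fun h ↦ hn ⟨j, h⟩).trans tsum_zero
  rw [← hinj.hasSum_iff fun n hn ↦ by
    rw [hcoeff, if_neg fun ⟨j, hj⟩ ↦ hn ⟨j, hj.symm⟩, zero_mul]]
  convert! hasSum_geometric_of_lt_one (pow_nonneg hx₀ a) (pow_lt_one₀ hx₀ hx₁ ha) using 2 with j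
  rw [Function.comp_apply, hcoeff, if_pos (dvd_mul_right a j), one_mul, pow_mul]

lemma restrictedPartitionCount_eq_card_restricted (A : Set ℕ) [DecidablePred (· ∈ A)] (n : ℕ) :
    restrictedPartitionCount A n = #(Nat.Partition.restricted n (· ∈ A)) := by
  rw [restrictedPartitionCount, Nat.card_eq_fintype_card, Fintype.card_subtype,
    Nat.Partition.restricted]

lemma powerSeriesMk_restrictedPartitionCount {B : Finset ℕ} (hB : 0 ∉ B) :
    PowerSeries.mk (fun n ↦ (restrictedPartitionCount B n : ℝ)) =
      ∏ a ∈ B, ∑' j : ℕ, X ^ (a * j) := by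
  have hmem (a : ℕ) : a ∈ (B : Set ℕ) ↔ a ∈ B := Finset.mem_coe
  simp_rw [restrictedPartitionCount_eq_card_restricted, hmem]
  have hsupport (a : ℕ) (ha : a ∉ Set.range (· + 1)) : a ∉ B := fun haB ↦
    ha ⟨a - 1, Nat.sub_add_cancel (Nat.pos_of_ne_zero (ne_of_mem_of_not_mem haB hB))⟩
  have hprod := hasProd_prod_of_ne_finset_one (s := B) (L := .unconditional ℕ)
    (f := fun a ↦ if a ∈ B then ∑' j : ℕ, (X : ℝ⟦X⟧) ^ (a * j) else 1) fun a ha ↦ if_neg ha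
  rw [prod_congr rfl fun a ha ↦ if_pos ha,
    ← (add_left_injective 1).hasProd_iff fun a ha ↦ if_neg (hsupport a ha)] at hprod
  exact (Nat.Partition.hasProd_powerSeriesMk_card_restricted ℝ (· ∈ B)).unique hprod

lemma hasSum_restrictedPartitionCount_mul_pow {B : Finset ℕ} (hB : 0 ∉ B) {x : ℝ} (hx₀ : 0 ≤ x)
    (hx₁ : x < 1) :
    HasSum (fun n ↦ restrictedPartitionCount B n * x ^ n) (∏ a ∈ B, (1 - x ^ a)⁻¹) := by
  have h := hasSum_coeff_prod_mul_pow B fun a ha ↦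
    hasSum_coeff_geometric_mul_pow (ne_of_mem_of_not_mem ha hB) hx₀ hx₁
  rw [← powerSeriesMk_restrictedPartitionCount hB] at h
  simpa only [coeff_mk] using h

end GeneratingFunction

/-- The logarithm `-log (1 - e ^ (-s a))` of the Euler factor `∑ₖ e ^ (-s k a)` that the part size
`a` contributes to the generating function of partitions at `e ^ (-s)`. For `a = 0` this is the
junk value `-log 0 = 0`. -/
noncomputable def logEulerFactor (s : ℝ) (a : ℕ) : ℝ :=
  -Real.log (1 - Real.exp (-(s * a)))

lemma exp_logEulerFactor {s : ℝ} (hs : 0 < s) {a : ℕ} (ha : a ≠ 0) :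
    Real.exp (logEulerFactor s a) = (1 - Real.exp (-s) ^ a)⁻¹ := by
  have hlt : Real.exp (-s) ^ a < 1 := pow_lt_one₀ (Real.exp_pos _).le (by simpa using hs) ha
  rw [logEulerFactor, ← Real.log_inv, mul_comm, ← mul_neg, Real.exp_nat_mul, Real.exp_log]
  exact inv_pos.2 (sub_pos.2 hlt)

lemma hasSum_restrictedPartitionCount_mul_exp {B : Finset ℕ} (hB : 0 ∉ B) {s : ℝ} (hs : 0 < s) :
    HasSum (fun n ↦ restrictedPartitionCount B n * Real.exp (-(s * n)))
      (Real.exp (∑ a ∈ B, logEulerFactor s a)) := by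
  rw [Real.exp_sum,
    Finset.prod_congr rfl fun a ha ↦ exp_logEulerFactor hs (ne_of_mem_of_not_mem ha hB)]
  convert! hasSum_restrictedPartitionCount_mul_pow hB (Real.exp_pos (-s)).le (by simpa using hs)
    using 3 with n
  rw [← Real.exp_nat_mul, mul_neg, mul_comm]

lemma restrictedPartitionCount_le_of_inter_Icc_subset {A B : Set ℕ} {n : ℕ}
    (h : A ∩ Set.Icc 1 n ⊆ B) : restrictedPartitionCount A n ≤ restrictedPartitionCount B n :=
  Nat.card_le_card_of_injective
    (Subtype.map id fun P hP i hi ↦ h ⟨hP i hi, P.parts_pos hi, P.le_of_mem_parts hi⟩)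
    (Subtype.map_injective _ Function.injective_id)

lemma restrictedPartitionCount_univ (n : ℕ) :
    restrictedPartitionCount Set.univ n = partitionCount n :=
  Nat.card_congr (Equiv.subtypeUnivEquiv fun _ i _ ↦ Set.mem_univ i)

lemma restrictedPartitionCount_le_partitionCount (A : Set ℕ) (n : ℕ) :
    restrictedPartitionCount A n ≤ partitionCount n :=
  (restrictedPartitionCount_le_of_inter_Icc_subset (Set.subset_univ _)).trans_eq
    (restrictedPartitionCount_univ n)

lemma restrictedPartitionCount_Icc {n D : ℕ} (h : n ≤ D) :
    restrictedPartitionCount (Finset.Icc 1 D) n = partitionCount n := by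
  refine (restrictedPartitionCount_le_partitionCount _ n).antisymm ?_
  rw [← restrictedPartitionCount_univ, Finset.coe_Icc]
  exact restrictedPartitionCount_le_of_inter_Icc_subset
    (Set.inter_subset_right.trans (Set.Icc_subset_Icc_right h))

lemma restrictedPartitionCount_le_exp {A : Set ℕ} {n : ℕ} {B : Finset ℕ} (hB : 0 ∉ B)
    (h : A ∩ Set.Icc 1 n ⊆ B) {s : ℝ} (hs : 0 < s) :
    restrictedPartitionCount A n ≤ Real.exp (s * n + ∑ a ∈ B, logEulerFactor s a) := by
  have hterm := le_hasSum (hasSum_restrictedPartitionCount_mul_exp hB hs) n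
    fun m _ ↦ by positivity
  calc (restrictedPartitionCount A n : ℝ) ≤ restrictedPartitionCount B n := by
        exact_mod_cast restrictedPartitionCount_le_of_inter_Icc_subset h
    _ = Real.exp (s * n) * (restrictedPartitionCount B n * Real.exp (-(s * n))) := by
        rw [mul_left_comm, ← Real.exp_add, add_neg_cancel, Real.exp_zero, mul_one]
    _ ≤ Real.exp (s * n + ∑ a ∈ B, logEulerFactor s a) := by
        rw [Real.exp_add]
        gcongr

lemma one_div_exp_sub_one_le {u : ℝ} (hu : 0 < u) : 1 / (Real.exp u - 1) ≤ 1 / u :=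
  one_div_le_one_div_of_le hu (by linarith [Real.add_one_le_exp u])

lemma tendsto_div_exp_sub_one : Tendsto (fun u ↦ u / (Real.exp u - 1)) (𝓝[>] 0) (𝓝 1) := by
  have h := (hasDerivAt_iff_tendsto_slope_zero.1 (Real.hasDerivAt_exp 0)).inv₀ (by simp)
  simpa [div_eq_mul_inv, mul_comm] using h.mono_left (nhdsGT_le_nhdsNE 0)

lemma hasSum_exp_neg_mul_succ {u : ℝ} (hu : 0 < u) :
    HasSum (fun a : ℕ ↦ Real.exp (-(u * (a + 1)))) (1 / (Real.exp u - 1)) := by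
  have hlt : Real.exp (-u) < 1 := by simpa using hu
  convert! (hasSum_geometric_of_lt_one (Real.exp_pos (-u)).le hlt).mul_left (Real.exp (-u)) using 1
  · ext a
    rw [← Real.exp_nat_mul, ← Real.exp_add]
    ring_nf
  · rw [← mul_inv_cancel_left₀ (Real.exp_pos u).ne' (Real.exp (-u)), Real.exp_neg]
    field_simp

lemma hasSum_one_div_succ_sq : HasSum (fun k : ℕ ↦ 1 / ((k : ℝ) + 1) ^ 2) (Real.pi ^ 2 / 6) := by
  simpa using (hasSum_nat_add_iff' 1).2 hasSum_zeta_two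

lemma hasSum_logEulerFactor_succ {s : ℝ} (hs : 0 < s) :
    HasSum (fun a ↦ logEulerFactor s (a + 1))
      (∑' k : ℕ, 1 / (k + 1) * (1 / (Real.exp (s * (k + 1)) - 1))) := by
  let f : ℕ × ℕ → ℝ := fun p ↦ 1 / (p.1 + 1) * Real.exp (-(s * (p.1 + 1) * (p.2 + 1)))
  have hrow (k : ℕ) :
      HasSum (fun a ↦ f (k, a)) (1 / (k + 1) * (1 / (Real.exp (s * (k + 1)) - 1))) :=
    (hasSum_exp_neg_mul_succ (by positivity)).mul_left _
  have hcol (a : ℕ) : HasSum (fun k ↦ f (k, a)) (logEulerFactor s (a + 1)) := by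
    have hlt : Real.exp (-(s * (a + 1))) < 1 :=
      Real.exp_lt_one_iff.2 (neg_lt_zero.2 (by positivity))
    have hlog := Real.hasSum_pow_div_log_of_abs_lt_one ((Real.abs_exp _).trans_lt hlt)
    convert! hlog using 2 with k
    · rw [← Real.exp_nat_mul]
      simp only [f, Nat.cast_add, Nat.cast_one]
      ring_nf
    · simp [logEulerFactor]
  have hf : Summable f := by
    refine (summable_prod_of_nonneg fun p ↦ by positivity).2 ⟨fun k ↦ (hrow k).summable, ?_⟩
    simp_rw [fun k ↦ (hrow k).tsum_eq]
    refine .of_nonneg_of_le (fun k ↦ ?_) (fun k ↦ ?_)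
      (hasSum_one_div_succ_sq.summable.mul_left (1 / s))
    · have := Real.one_le_exp (x := s * (k + 1)) (by positivity)
      exact mul_nonneg (by positivity) (one_div_nonneg.2 (by linarith))
    · calc
        _ ≤ 1 / (k + 1) * (1 / (s * (k + 1))) :=
          mul_le_mul_of_nonneg_left (one_div_exp_sub_one_le (by positivity)) (by positivity)
        _ = _ := by field_simp
  rw [(hf.hasSum.prod_fiberwise hrow).tsum_eq]
  exact ((Equiv.prodComm ℕ ℕ).hasSum_iff.2 hf.hasSum).prod_fiberwise hcol

lemma tendsto_const_mul_nhdsGT_zero {c : ℝ} (hc : 0 < c) :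
    Tendsto (fun s ↦ c * s) (𝓝[>] 0) (𝓝[>] 0) :=
  tendsto_iff_comap.2 (comap_mulLeft_nhdsGT_zero hc).ge

lemma tendsto_mul_tsum_logEulerFactor_succ :
    Tendsto (fun s ↦ s * ∑' a, logEulerFactor s (a + 1)) (𝓝[>] 0) (𝓝 (Real.pi ^ 2 / 6)) := by
  rw [← hasSum_one_div_succ_sq.tsum_eq]
  have hdom : Tendsto
      (fun s : ℝ ↦ ∑' k : ℕ, s * (1 / (k + 1) * (1 / (Real.exp (s * (k + 1)) - 1)))) (𝓝[>] 0)
      (𝓝 (∑' k : ℕ, 1 / ((k : ℝ) + 1) ^ 2)) := by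
    refine tendsto_tsum_of_dominated_convergence hasSum_one_div_succ_sq.summable (fun k ↦ ?_) ?_
    · have hlim : Tendsto (fun s : ℝ ↦ s * (k + 1)) (𝓝[>] 0) (𝓝[>] 0) := by
        simpa only [mul_comm] using tendsto_const_mul_nhdsGT_zero (k.cast_add_one_pos (α := ℝ))
      convert! (tendsto_div_exp_sub_one.comp hlim).mul_const (1 / ((k : ℝ) + 1) ^ 2) using 1
      · ext s
        simp only [Function.comp_apply]
        field_simp
      · rw [one_mul]
    · filter_upwards [self_mem_nhdsWithin] with s (hs : 0 < s) k
      have hexp := Real.one_le_exp (x := s * (k + 1)) (by positivity)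
      rw [Real.norm_of_nonneg
        (mul_nonneg hs.le (mul_nonneg (by positivity) (one_div_nonneg.2 (by linarith))))]
      calc
        _ ≤ s * (1 / (k + 1) * (1 / (s * (k + 1)))) := by
          gcongr s * (_ * ?_)
          exact one_div_exp_sub_one_le (by positivity)
        _ = _ := by field_simp
  refine hdom.congr' ?_
  filter_upwards [self_mem_nhdsWithin] with s (hs : 0 < s)
  rw [tsum_mul_left, (hasSum_logEulerFactor_succ hs).tsum_eq]

lemma hasSum_partitionCount_mul_exp {s : ℝ} (hs : 0 < s) :
    HasSum (fun n ↦ partitionCount n * Real.exp (-(s * n)))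
      (Real.exp (∑' a, logEulerFactor s (a + 1))) := by
  have hIcc (D : ℕ) := hasSum_restrictedPartitionCount_mul_exp (B := Finset.Icc 1 D) (by simp) hs
  have hsum (D : ℕ) : ∑ a ∈ Finset.Icc 1 D, logEulerFactor s a =
      ∑ a ∈ Finset.range D, logEulerFactor s (a + 1) := by
    rw [Finset.range_eq_Ico, Finset.sum_Ico_add' (logEulerFactor s)]
    rfl
  have hlim : Tendsto (fun D ↦ Real.exp (∑ a ∈ Finset.Icc 1 D, logEulerFactor s a)) atTop
      (𝓝 (Real.exp (∑' a, logEulerFactor s (a + 1)))) := by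
    simp_rw [hsum]
    exact (Real.continuous_exp.tendsto _).comp
      (hasSum_logEulerFactor_succ hs).summable.hasSum.tendsto_sum_nat
  have hpartial (N : ℕ) : ∑ n ∈ Finset.range N, partitionCount n * Real.exp (-(s * n)) ≤
      Real.exp (∑' a, logEulerFactor s (a + 1)) := by
    refine ge_of_tendsto hlim (eventually_atTop.2 ⟨N, fun D hD ↦ ?_⟩)
    refine le_trans (Finset.sum_le_sum fun n hn ↦ ?_)
      (sum_le_hasSum (Finset.range N) (fun n _ ↦ by positivity) (hIcc D))
    rw [restrictedPartitionCount_Icc ((Finset.mem_range.1 hn).le.trans hD)]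
  have hsummable := summable_of_sum_range_le (fun n ↦ by positivity) hpartial
  refine hsummable.hasSum_iff.2
    ((Real.tsum_le_of_sum_range_le (fun n ↦ by positivity) hpartial).antisymm ?_)
  refine le_of_tendsto' hlim fun D ↦ hasSum_le (fun n ↦ ?_) (hIcc D) hsummable.hasSum
  gcongr
  exact restrictedPartitionCount_le_partitionCount _ n

/-! ### A Tauberian theorem -/

lemma neg_log_one_sub_exp_neg_le {u : ℝ} (hu : 0 < u) :
    -Real.log (1 - Real.exp (-u)) ≤ Real.log (1 + 1 / u) := by
  have hexp : 0 < Real.exp u - 1 := sub_pos.2 (Real.one_lt_exp_iff.2 hu)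
  have hinv : (1 - Real.exp (-u))⁻¹ = 1 + 1 / (Real.exp u - 1) := by
    rw [Real.exp_neg]
    field_simp
    ring
  rw [← Real.log_inv, hinv]
  exact Real.log_le_log (by positivity) (add_le_add_right (one_div_exp_sub_one_le hu) 1)

lemma tendsto_mul_log_one_sub_exp_neg {c : ℝ} (hc : 0 < c) :
    Tendsto (fun s ↦ s * Real.log (1 - Real.exp (-(c * s)))) (𝓝[>] 0) (𝓝 0) := by
  have hlower : Tendsto (fun s ↦ c⁻¹ * (c * s * Real.log (c * s)) - s * Real.log (1 + c * s))
      (𝓝[>] 0) (𝓝 0) := by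
    have hlog : Continuous fun s ↦ c * s * Real.log (c * s) :=
      Real.continuous_mul_log.comp (continuous_const_mul c)
    have hlog_one_add : ContinuousAt (fun s ↦ s * Real.log (1 + c * s)) 0 := by
      fun_prop (disch := simp)
    simpa using (((hlog.const_mul c⁻¹).tendsto 0).sub hlog_one_add.tendsto).mono_left
      nhdsWithin_le_nhds
  refine tendsto_of_tendsto_of_tendsto_of_le_of_le' hlower tendsto_const_nhds ?_ ?_ <;>
    filter_upwards [self_mem_nhdsWithin] with s (hs : 0 < s)
  · have hlog := neg_log_one_sub_exp_neg_le (mul_pos hc hs)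
    rw [one_add_div (by positivity), add_comm (c * s), Real.log_div (by positivity) (by positivity)]
      at hlog
    have hmul := mul_le_mul_of_nonneg_left hlog hs.le
    have hcancel : c⁻¹ * (c * s * Real.log (c * s)) = s * Real.log (c * s) := by field_simp
    linarith
  · exact mul_nonpos_of_nonneg_of_nonpos hs.le (Real.log_nonpos
      (sub_nonneg.2 (Real.exp_le_one_iff.2 (neg_nonpos.2 (by positivity))))
      (sub_le_self 1 (Real.exp_pos _).le))

section Tauberian

/-- The Laplace transform `∑ₙ f(n) e ^ (-s n)` of a sequence `f`, that is, its generating function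
in the variable `e ^ (-s)`. -/
noncomputable def laplaceSum (f : ℕ → ℝ) (s : ℝ) : ℝ :=
  ∑' n, f n * Real.exp (-(s * n))

variable {f : ℕ → ℝ} {b : ℝ}

lemma laplaceSum_pos (hpos : ∀ n, 0 < f n) {s : ℝ}
    (hsum : Summable fun n ↦ f n * Real.exp (-(s * n))) :
    0 < laplaceSum f s :=
  hsum.tsum_pos (fun n ↦ (mul_pos (hpos n) (Real.exp_pos _)).le) 0
    (mul_pos (hpos 0) (Real.exp_pos _))

lemma log_le_mul_add_log_laplaceSum (hpos : ∀ n, 0 < f n) {s : ℝ}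
    (hsum : Summable fun n ↦ f n * Real.exp (-(s * n))) (n : ℕ) :
    Real.log (f n) ≤ s * n + Real.log (laplaceSum f s) := by
  have hterm : f n * Real.exp (-(s * n)) ≤ laplaceSum f s :=
    hsum.le_tsum n fun k _ ↦ (mul_pos (hpos k) (Real.exp_pos _)).le
  have hlog := Real.log_le_log (mul_pos (hpos n) (Real.exp_pos _)) hterm
  rw [Real.log_mul (hpos n).ne' (Real.exp_ne_zero _), Real.log_exp] at hlog
  linarith

lemma tendsto_sqrt_div_natCast (hb : 0 < b) : Tendsto (fun n : ℕ ↦ √(b / n)) atTop (𝓝[>] 0) := by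
  refine tendsto_nhdsWithin_iff.2 ⟨?_, ?_⟩
  · simpa using (tendsto_const_div_atTop_nhds_zero_nat b).sqrt
  · filter_upwards [eventually_gt_atTop 0] with n hn
    exact Real.sqrt_pos.2 (by positivity)

lemma sqrt_div_mul_sqrt (b : ℝ) {n : ℕ} (hn : 0 < n) : √(b / n) * √n = √b := by
  rw [← Real.sqrt_mul' _ n.cast_nonneg, div_mul_cancel₀ _ (by positivity)]

lemma eventually_log_div_sqrt_lt (hpos : ∀ n, 0 < f n)
    (hsum : ∀ s > 0, Summable fun n ↦ f n * Real.exp (-(s * n))) (hb : 0 < b)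
    (hF : Tendsto (fun s ↦ s * Real.log (laplaceSum f s)) (𝓝[>] 0) (𝓝 b)) {c : ℝ}
    (hc : 2 * √b < c) : ∀ᶠ n : ℕ in atTop, Real.log (f n) / √n < c := by
  have hlim : Tendsto (fun n : ℕ ↦ √b + √(b / n) * Real.log (laplaceSum f √(b / n)) / √b) atTop
      (𝓝 (√b + b / √b)) :=
    ((hF.comp (tendsto_sqrt_div_natCast hb)).div_const _).const_add _
  rw [Real.div_sqrt, ← two_mul] at hlim
  filter_upwards [hlim.eventually_lt_const hc, eventually_gt_atTop 0] with n hlt hn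
  refine lt_of_le_of_lt ?_ hlt
  have hs : 0 < √(b / n) := Real.sqrt_pos.2 (by positivity)
  have hlog := log_le_mul_add_log_laplaceSum hpos (hsum _ hs) n
  have hsqrt := sqrt_div_mul_sqrt b hn
  have hsn : √(b / n) * n = √b * √n := by
    rw [← hsqrt, mul_assoc, Real.mul_self_sqrt n.cast_nonneg]
  have hsqrtn : (0 : ℝ) < √n := by positivity
  calc Real.log (f n) / √n ≤ (√(b / n) * n + Real.log (laplaceSum f √(b / n))) / √n := by gcongr
    _ = √b + √(b / n) * Real.log (laplaceSum f √(b / n)) / √b := by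
      rw [hsn, add_div, mul_div_cancel_right₀ _ hsqrtn.ne', ← hsqrt,
        mul_div_mul_left _ _ hs.ne']

/- Tilting the exponent from `s` to `(1 + t) s`: for `t = δ` this bounds the terms with
`n ≤ (1 - 2 δ) b / s ^ 2` of the sum, for `t = -δ` those with `n ≥ (1 + 2 δ) b / s ^ 2`, so at least
a third of the sum comes from the terms in between. -/
lemma eventually_exp_mul_laplaceSum_le (hpos : ∀ n, 0 < f n)
    (hsum : ∀ s > 0, Summable fun n ↦ f n * Real.exp (-(s * n))) (hb : 0 < b)
    (hF : Tendsto (fun s ↦ s * Real.log (laplaceSum f s)) (𝓝[>] 0) (𝓝 b)) {t : ℝ}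
    (ht : t ≠ 0) (ht' : -(1 / 2) < t) : ∀ᶠ s in 𝓝[>] 0,
      Real.exp (t * ((1 - 2 * t) * b / s)) * laplaceSum f ((1 + t) * s) ≤ laplaceSum f s / 3 := by
  have ht₁ : 0 < 1 + t := by linarith
  have hleft : Tendsto (fun s ↦ t * (1 - 2 * t) * b +
      (1 + t) * s * Real.log (laplaceSum f ((1 + t) * s)) / (1 + t)) (𝓝[>] 0)
      (𝓝 (t * (1 - 2 * t) * b + b / (1 + t))) :=
    ((hF.comp (tendsto_const_mul_nhdsGT_zero ht₁)).div_const _).const_add _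
  have hright : Tendsto (fun s ↦ s * Real.log (laplaceSum f s) - s * Real.log 3) (𝓝[>] 0)
      (𝓝 (b - 0 * Real.log 3)) :=
    hF.sub ((tendsto_id.mono_left nhdsWithin_le_nhds).mul_const _)
  have hlt : t * (1 - 2 * t) * b + b / (1 + t) < b - 0 * Real.log 3 := by
    have : 0 < b * (t ^ 2 * (1 + 2 * t)) := by
      have : 0 < 1 + 2 * t := by linarith
      positivity
    rw [zero_mul, sub_zero, ← lt_sub_iff_add_lt', div_lt_iff₀ ht₁]
    linarith
  filter_upwards [hleft.eventually_lt hright hlt, self_mem_nhdsWithin] with s hs (hs₀ : 0 < s)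
  have hF₁ := laplaceSum_pos hpos (hsum s hs₀)
  have hF₂ := laplaceSum_pos hpos (hsum ((1 + t) * s) (by positivity))
  rw [← Real.log_le_log_iff (by positivity) (by positivity),
    Real.log_mul (Real.exp_ne_zero _) hF₂.ne', Real.log_exp, Real.log_div hF₁.ne' (by norm_num)]
  refine le_of_mul_le_mul_left ?_ hs₀
  convert! hs.le using 1
  · field_simp
  · ring

lemma mul_exp_neg_le_split (hmono : Monotone f) (hpos : ∀ n, 0 < f n) {s δ : ℝ} (hs : 0 < s)
    (hδ : 0 < δ) (hδ' : δ < 1) (r : ℝ) (n k : ℕ) :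
    f k * Real.exp (-(s * k)) ≤
      Real.exp (δ * (s * r)) * (f k * Real.exp (-((1 + δ) * s * k))) +
      Real.exp (-δ * (s * n)) * (f k * Real.exp (-((1 + -δ) * s * k))) +
      f n * Real.exp (-((1 - δ) * (s * r))) * Real.exp (-(δ * s)) ^ k := by
  have hfk := hpos k
  have hfn := hpos n
  have h₁ : 0 ≤ Real.exp (δ * (s * r)) * (f k * Real.exp (-((1 + δ) * s * k))) := by positivity
  have h₂ : 0 ≤ Real.exp (-δ * (s * n)) * (f k * Real.exp (-((1 + -δ) * s * k))) := by positivity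
  have h₃ : 0 ≤ f n * Real.exp (-((1 - δ) * (s * r))) * Real.exp (-(δ * s)) ^ k := by positivity
  rcases le_total (k : ℝ) r with hkr | hkr
  · suffices f k * Real.exp (-(s * k)) ≤
        Real.exp (δ * (s * r)) * (f k * Real.exp (-((1 + δ) * s * k))) by linarith
    rw [mul_left_comm, ← Real.exp_add]
    gcongr
    linarith [mul_le_mul_of_nonneg_left hkr (mul_pos hδ hs).le]
  rcases le_total n k with hnk | hkn
  · suffices f k * Real.exp (-(s * k)) ≤
        Real.exp (-δ * (s * n)) * (f k * Real.exp (-((1 + -δ) * s * k))) by linarith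
    rw [mul_left_comm, ← Real.exp_add]
    gcongr
    have : (n : ℝ) ≤ k := by exact_mod_cast hnk
    linarith [mul_le_mul_of_nonneg_left this (mul_pos hδ hs).le]
  · suffices f k * Real.exp (-(s * k)) ≤
        f n * Real.exp (-((1 - δ) * (s * r))) * Real.exp (-(δ * s)) ^ k by linarith
    rw [← Real.exp_nat_mul, mul_assoc, ← Real.exp_add]
    gcongr
    · exact hmono hkn
    · linarith [mul_le_mul_of_nonneg_left hkr (mul_pos (sub_pos.2 hδ') hs).le]

lemma laplaceSum_le_split (hmono : Monotone f) (hpos : ∀ n, 0 < f n)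
    (hsum : ∀ s > 0, Summable fun n ↦ f n * Real.exp (-(s * n))) {s δ : ℝ} (hs : 0 < s)
    (hδ : 0 < δ) (hδ' : δ < 1) (r : ℝ) (n : ℕ) :
    laplaceSum f s ≤ Real.exp (δ * (s * r)) * laplaceSum f ((1 + δ) * s) +
      Real.exp (-δ * (s * n)) * laplaceSum f ((1 + -δ) * s) +
      f n * Real.exp (-((1 - δ) * (s * r))) * (1 - Real.exp (-(δ * s)))⁻¹ := by
  have hgeom := hasSum_geometric_of_lt_one (Real.exp_pos (-(δ * s))).le
    (Real.exp_lt_one_iff.2 (neg_lt_zero.2 (mul_pos hδ hs)))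
  exact hasSum_le (mul_exp_neg_le_split hmono hpos hs hδ hδ' r n) (hsum s hs).hasSum
    ((((hsum _ (by positivity)).hasSum.mul_left _).add
      ((hsum _ (mul_pos (by linarith) hs)).hasSum.mul_left _)).add (hgeom.mul_left _))

lemma eventually_mul_log_le (hmono : Monotone f) (hpos : ∀ n, 0 < f n)
    (hsum : ∀ s > 0, Summable fun n ↦ f n * Real.exp (-(s * n))) (hb : 0 < b)
    (hF : Tendsto (fun s ↦ s * Real.log (laplaceSum f s)) (𝓝[>] 0) (𝓝 b)) {δ : ℝ}
    (hδ : 0 < δ) (hδ' : δ < 1 / 2) : ∀ᶠ s in 𝓝[>] 0, ∀ n : ℕ, s ^ 2 * n = (1 + 2 * δ) * b →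
      s * Real.log (laplaceSum f s) - s * Real.log 3 + (1 - δ) * ((1 - 2 * δ) * b) +
        s * Real.log (1 - Real.exp (-(δ * s))) ≤ s * Real.log (f n) := by
  filter_upwards [eventually_exp_mul_laplaceSum_le hpos hsum hb hF hδ.ne' (by linarith),
    eventually_exp_mul_laplaceSum_le hpos hsum hb hF (neg_ne_zero.2 hδ.ne') (by linarith),
    self_mem_nhdsWithin] with s h₁ h₂ (hs : 0 < s) n hn
  have hsn : s * n = (1 - 2 * -δ) * b / s := by
    rw [eq_div_iff hs.ne']
    linarith
  have hF₁ := laplaceSum_pos hpos (hsum s hs)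
  have hsplit := laplaceSum_le_split hmono hpos hsum hs hδ (by linarith) ((1 - 2 * δ) * b / s ^ 2) n
  rw [hsn, show s * ((1 - 2 * δ) * b / s ^ 2) = (1 - 2 * δ) * b / s by field_simp] at hsplit
  have hexp : 0 < 1 - Real.exp (-(δ * s)) :=
    sub_pos.2 (Real.exp_lt_one_iff.2 (neg_lt_zero.2 (mul_pos hδ hs)))
  have hthird : laplaceSum f s / 3 ≤
      f n * Real.exp (-((1 - δ) * ((1 - 2 * δ) * b / s))) * (1 - Real.exp (-(δ * s)))⁻¹ := by
    linarith
  have hlog := Real.log_le_log (by positivity) hthird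
  rw [Real.log_div hF₁.ne' (by norm_num),
    Real.log_mul (mul_pos (hpos n) (Real.exp_pos _)).ne' (inv_pos.2 hexp).ne',
    Real.log_mul (hpos n).ne' (Real.exp_ne_zero _), Real.log_exp, Real.log_inv] at hlog
  have hmul := mul_le_mul_of_nonneg_left hlog hs.le
  rw [mul_sub, mul_add, mul_add] at hmul
  have hcancel : s * -((1 - δ) * ((1 - 2 * δ) * b / s)) = -((1 - δ) * ((1 - 2 * δ) * b)) := by
    field_simp
  linarith

lemma tendsto_add_mul_div_sqrt_nhds_zero (hb : 0 < b) :
    Tendsto (fun δ ↦ (b + (1 - δ) * ((1 - 2 * δ) * b)) / √((1 + 2 * δ) * b)) (𝓝 0)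
      (𝓝 (2 * √b)) := by
  have hcont : ContinuousAt
      (fun δ ↦ (b + (1 - δ) * ((1 - 2 * δ) * b)) / √((1 + 2 * δ) * b)) 0 := by
    have hsqrt : √((1 + 2 * 0) * b) ≠ 0 := by simpa using (Real.sqrt_pos.2 hb).ne'
    fun_prop (disch := assumption)
  convert! hcont.tendsto using 2
  norm_num
  rw [← two_mul, mul_div_assoc, Real.div_sqrt]

lemma eventually_lt_log_div_sqrt (hmono : Monotone f) (hpos : ∀ n, 0 < f n)
    (hsum : ∀ s > 0, Summable fun n ↦ f n * Real.exp (-(s * n))) (hb : 0 < b)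
    (hF : Tendsto (fun s ↦ s * Real.log (laplaceSum f s)) (𝓝[>] 0) (𝓝 b)) {c : ℝ}
    (hc : c < 2 * √b) : ∀ᶠ n : ℕ in atTop, c < Real.log (f n) / √n := by
  obtain ⟨δ, hδc, hδ, hδ'⟩ : ∃ δ : ℝ, c < _ ∧ 0 < δ ∧ δ < 1 / 2 :=
    ((((tendsto_add_mul_div_sqrt_nhds_zero hb).mono_left nhdsWithin_le_nhds).eventually_const_lt
      hc).and (Ioo_mem_nhdsGT (by norm_num : (0 : ℝ) < 1 / 2))).exists
  have hlog3 : Tendsto (fun s ↦ s * Real.log 3) (𝓝[>] 0) (𝓝 0) := by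
    simpa using (tendsto_id.mul_const (Real.log 3)).mono_left (nhdsWithin_le_nhds (a := (0 : ℝ)))
  have hlim := ((hF.sub hlog3).add_const ((1 - δ) * ((1 - 2 * δ) * b))).add
    (tendsto_mul_log_one_sub_exp_neg hδ)
  rw [sub_zero, add_zero] at hlim
  have hs := tendsto_sqrt_div_natCast (b := (1 + 2 * δ) * b) (by positivity)
  filter_upwards [((hlim.div_const _).comp hs).eventually_const_lt hδc,
    hs.eventually (eventually_mul_log_le hmono hpos hsum hb hF hδ hδ'),
    eventually_gt_atTop 0] with n hlt hle hn
  have hs₀ : 0 < √((1 + 2 * δ) * b / n) := by positivity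
  specialize hle n (by rw [Real.sq_sqrt (by positivity)]; field_simp)
  refine hlt.trans_le ?_
  calc _ ≤ √((1 + 2 * δ) * b / n) * Real.log (f n) / √((1 + 2 * δ) * b) := by
        simp only [Function.comp_apply]
        gcongr
    _ = Real.log (f n) / √n := by
        rw [← sqrt_div_mul_sqrt ((1 + 2 * δ) * b) hn, mul_div_mul_left _ _ hs₀.ne']

theorem tendsto_log_div_sqrt_of_tendsto_mul_log_laplaceSum (hmono : Monotone f)
    (hpos : ∀ n, 0 < f n) (hsum : ∀ s > 0, Summable fun n ↦ f n * Real.exp (-(s * n)))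
    (hb : 0 < b) (hF : Tendsto (fun s ↦ s * Real.log (laplaceSum f s)) (𝓝[>] 0) (𝓝 b)) :
    Tendsto (fun n : ℕ ↦ Real.log (f n) / √n) atTop (𝓝 (2 * √b)) :=
  tendsto_order.2 ⟨fun _ ↦ eventually_lt_log_div_sqrt hmono hpos hsum hb hF,
    fun _ ↦ eventually_log_div_sqrt_lt hpos hsum hb hF⟩

end Tauberian

/-! ### Asymptotics of the partition function -/

lemma restrictedPartitionCount_le_succ {A : Set ℕ} (h1 : 1 ∈ A) (n : ℕ) :
    restrictedPartitionCount A n ≤ restrictedPartitionCount A (n + 1) := by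
  let addOne (P : Nat.Partition n) : Nat.Partition (n + 1) :=
    ⟨1 ::ₘ P.parts, by simpa using fun i hi ↦ P.parts_pos hi, by simp [P.parts_sum, add_comm]⟩
  have haddOne : Function.Injective addOne := fun P Q h ↦
    Nat.Partition.ext ((Multiset.cons_inj_right 1).1 (congrArg Nat.Partition.parts h))
  exact Nat.card_le_card_of_injective
    (Subtype.map addOne fun P hP ↦ by simpa [addOne] using ⟨h1, hP⟩)
    (Subtype.map_injective _ haddOne)

lemma one_le_restrictedPartitionCount {A : Set ℕ} (h1 : 1 ∈ A) (n : ℕ) :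
    1 ≤ restrictedPartitionCount A n :=
  have hparts : ∀ i ∈ Multiset.replicate n 1, i = 1 := fun _ ↦ Multiset.eq_of_mem_replicate
  Nat.card_pos_iff.2 ⟨⟨⟨⟨Multiset.replicate n 1, fun hi ↦ (hparts _ hi).symm ▸ one_pos, by simp⟩,
    fun i hi ↦ (hparts i hi).symm ▸ h1⟩⟩, inferInstance⟩

lemma monotone_partitionCount : Monotone partitionCount :=
  monotone_nat_of_le_succ fun n ↦ by
    simpa only [restrictedPartitionCount_univ] using
      restrictedPartitionCount_le_succ (Set.mem_univ 1) n

lemma partitionCount_pos (n : ℕ) : 0 < partitionCount n := by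
  rw [← restrictedPartitionCount_univ]
  exact one_le_restrictedPartitionCount (Set.mem_univ 1) n

theorem tendsto_log_partitionCount_div_sqrt :
    Tendsto (fun n : ℕ ↦ Real.log (partitionCount n) / √n) atTop (𝓝 (2 * (Real.pi / √6))) := by
  have hF : Tendsto (fun s ↦ s * Real.log (laplaceSum (fun n ↦ partitionCount n) s)) (𝓝[>] 0)
      (𝓝 (Real.pi ^ 2 / 6)) := by
    refine tendsto_mul_tsum_logEulerFactor_succ.congr' ?_
    filter_upwards [self_mem_nhdsWithin] with s (hs : 0 < s)
    rw [laplaceSum, (hasSum_partitionCount_mul_exp hs).tsum_eq, Real.log_exp]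
  have h := tendsto_log_div_sqrt_of_tendsto_mul_log_laplaceSum
    (fun m n hmn ↦ Nat.cast_le.2 (monotone_partitionCount hmn))
    (fun n ↦ Nat.cast_pos.2 (partitionCount_pos n))
    (fun s hs ↦ (hasSum_partitionCount_mul_exp hs).summable) (by positivity) hF
  rwa [Real.sqrt_div (sq_nonneg _), Real.sqrt_sq Real.pi_pos.le] at h

lemma tendsto_log_partitionCount_floor_div_sqrt {α : ℝ} (hα : 0 < α) :
    Tendsto (fun n : ℕ ↦ Real.log (partitionCount ⌊α * (n : ℝ)⌋₊) / √(α * n)) atTop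
      (𝓝 (2 * (Real.pi / √6))) := by
  have hαn : Tendsto (fun n : ℕ ↦ α * (n : ℝ)) atTop atTop :=
    tendsto_natCast_atTop_atTop.const_mul_atTop hα
  have hfloor : Tendsto (fun n : ℕ ↦ √(⌊α * (n : ℝ)⌋₊ / (α * n))) atTop (𝓝 √1) :=
    ((tendsto_nat_floor_div_atTop (R := ℝ)).comp hαn).sqrt
  have h := (tendsto_log_partitionCount_div_sqrt.comp
    (tendsto_nat_floor_atTop.comp hαn)).mul hfloor
  rw [Real.sqrt_one, mul_one] at h
  refine h.congr' ?_
  filter_upwards [(tendsto_nat_floor_atTop.comp hαn).eventually_gt_atTop 0] with n hn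
  have hn' : 0 < √(⌊α * (n : ℝ)⌋₊ : ℝ) := Real.sqrt_pos.2 (Nat.cast_pos.2 hn)
  rw [Real.sqrt_div (Nat.cast_nonneg _)]
  exact div_mul_div_cancel₀ hn'.ne'

lemma tendsto_mul_sqrt_div_log_partitionCount {α : ℝ} (hα : 0 < α) (c : ℝ) :
    Tendsto
      (fun n : ℕ ↦ ((2 * c * √(α * n) / Real.log (partitionCount ⌊α * (n : ℝ)⌋₊) : ℝ) : EReal))
      atTop (𝓝 ((√6 / Real.pi * c : ℝ) : EReal)) := by
  have h := ((tendsto_log_partitionCount_floor_div_sqrt hα).inv₀ (by positivity)).const_mul (2 * c)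
  refine (continuous_coe_real_ereal.tendsto _).comp ?_
  convert! h using 1
  · ext n
    rw [inv_div, mul_div_assoc]
  · congr 1
    field_simp

lemma ennrealLog_natCast_le_coe_iff {k : ℕ} {y : ℝ} :
    ENNReal.log k ≤ (y : EReal) ↔ (k : ℝ) ≤ Real.exp y := by
  rw [← Real.log_exp y, ← ENNReal.log_ofReal_of_pos (Real.exp_pos y), ENNReal.log_le_log_iff,
    ← ENNReal.ofReal_natCast, ENNReal.ofReal_le_ofReal_iff (Real.exp_pos _).le, Real.log_exp]

lemma coe_le_ennrealLog_natCast_iff {k : ℕ} {y : ℝ} :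
    (y : EReal) ≤ ENNReal.log k ↔ Real.exp y ≤ (k : ℝ) := by
  rw [← Real.log_exp y, ← ENNReal.log_ofReal_of_pos (Real.exp_pos y), ENNReal.log_le_log_iff,
    ← ENNReal.ofReal_natCast, ENNReal.ofReal_le_ofReal_iff k.cast_nonneg, Real.log_exp]

lemma liminfLogRatio_le_of_frequently {A : Set ℕ} {α c : ℝ} (hα : 0 < α)
    (h : ∃ᶠ n : ℕ in atTop, restrictedPartitionCount A n ≤ Real.exp (2 * c * √(α * n))) :
    liminfLogRatio A α ≤ (√6 / Real.pi * c : ℝ) := by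
  set S : Set ℕ := {n | restrictedPartitionCount A n ≤ Real.exp (2 * c * √(α * n))}
  have : NeBot (atTop ⊓ 𝓟 S) := frequently_mem_iff_neBot.1 h
  rw [← ((tendsto_mul_sqrt_div_log_partitionCount hα c).mono_left
    (inf_le_left : atTop ⊓ 𝓟 S ≤ atTop)).liminf_eq]
  refine (liminf_le_liminf_of_le inf_le_left).trans (liminf_le_liminf ?_)
  filter_upwards [mem_inf_of_right (mem_principal_self _)] with n hn
  rw [EReal.coe_div]
  exact EReal.div_le_div_right_of_nonneg (EReal.coe_nonneg.2 (Real.log_natCast_nonneg _))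
    (ennrealLog_natCast_le_coe_iff.2 hn)

lemma le_liminfLogRatio_of_eventually {A : Set ℕ} {α c : ℝ} (hα : 0 < α)
    (h : ∀ᶠ n : ℕ in atTop, Real.exp (2 * c * √(α * n)) ≤ restrictedPartitionCount A n) :
    (√6 / Real.pi * c : ℝ) ≤ liminfLogRatio A α := by
  rw [← (tendsto_mul_sqrt_div_log_partitionCount hα c).liminf_eq]
  refine liminf_le_liminf (h.mono fun n hn ↦ ?_)
  rw [EReal.coe_div]
  exact EReal.div_le_div_right_of_nonneg (EReal.coe_nonneg.2 (Real.log_natCast_nonneg _))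
    (coe_le_ennrealLog_natCast_iff.2 hn)

/-! ### The upper bound -/

lemma log_one_add_one_div_mul_le {s τ a : ℝ} (hs : 0 < s) (hτ : 0 < τ) (ha : 0 < a) :
    Real.log (1 + 1 / (s * a)) ≤ Real.log (1 + 1 / (s * τ)) + Real.posLog (τ / a) := by
  have hmax : 0 < max 1 (τ / a) := by positivity
  rw [Real.posLog_eq_log_max_one (by positivity), ← Real.log_mul (by positivity) hmax.ne']
  refine Real.log_le_log (by positivity) ?_
  calc 1 + 1 / (s * a) = 1 + 1 / (s * τ) * (τ / a) := by field_simp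
    _ ≤ max 1 (τ / a) + 1 / (s * τ) * max 1 (τ / a) := by gcongr <;> simp
    _ = (1 + 1 / (s * τ)) * max 1 (τ / a) := by ring

lemma sum_posLog_div_le {τ : ℝ} (hτ : 0 < τ) {T : Finset ℕ} (hT : 0 ∉ T) :
    ∑ a ∈ T, Real.posLog (τ / a) ≤ τ := by
  set k := ⌊τ⌋₊
  have hzero : ∀ a ∈ T ∪ Finset.Icc 1 k, a ∉ Finset.Icc 1 k → Real.posLog (τ / a) = 0 := by
    intro a ha hak
    have hapos : 0 < a := Nat.pos_of_ne_zero fun h ↦ by simp_all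
    have hτa : τ < a := (Nat.floor_lt hτ.le).1 (by rw [Finset.mem_Icc] at hak; lia)
    rw [Real.posLog_eq_zero_iff, abs_of_pos (by positivity)]
    exact (div_le_one₀ (by positivity)).2 hτa.le
  have hlog : ∀ a ∈ Finset.Icc 1 k, Real.posLog (τ / a) = Real.log (τ / a) := by
    intro a ha
    obtain ⟨h1, hk⟩ := Finset.mem_Icc.1 ha
    have hapos : (0 : ℝ) < a := by exact_mod_cast h1
    refine Real.posLog_eq_log ?_
    rw [abs_of_pos (by positivity)]
    exact (one_le_div₀ hapos).2 ((Nat.le_floor_iff hτ.le).1 hk)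
  calc ∑ a ∈ T, Real.posLog (τ / a) ≤ ∑ a ∈ T ∪ Finset.Icc 1 k, Real.posLog (τ / a) :=
        Finset.sum_le_sum_of_subset_of_nonneg Finset.subset_union_left
          fun _ _ _ ↦ Real.posLog_nonneg
    _ = ∑ a ∈ Finset.Icc 1 k, Real.log (τ / a) := by
        rw [← Finset.sum_subset Finset.subset_union_right hzero, Finset.sum_congr rfl hlog]
    _ = Real.log (τ ^ k / k.factorial) := by
        rw [← Finset.prod_Ico_id_eq_factorial, Finset.Ico_add_one_right_eq_Icc, Nat.cast_prod,
          ← Real.log_prod]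
        · simp [Finset.prod_div_distrib]
        · intro a ha
          have := (Finset.mem_Icc.1 ha).1
          positivity
    _ ≤ τ := (Real.log_le_iff_le_exp (by positivity)).2
        (Real.pow_div_factorial_le_exp τ hτ.le k)

lemma sum_logEulerFactor_le {s τ : ℝ} (hs : 0 < s) (hτ : 0 < τ) {T : Finset ℕ} (hT : 0 ∉ T) :
    ∑ a ∈ T, logEulerFactor s a ≤ T.card * Real.log (1 + 1 / (s * τ)) + τ := by
  calc ∑ a ∈ T, logEulerFactor s a
      ≤ ∑ a ∈ T, (Real.log (1 + 1 / (s * τ)) + Real.posLog (τ / a)) := by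
        refine Finset.sum_le_sum fun a ha ↦ ?_
        have hapos : (0 : ℝ) < a := by
          exact_mod_cast Nat.pos_of_ne_zero (ne_of_mem_of_not_mem ha hT)
        exact (neg_log_one_sub_exp_neg_le (by positivity)).trans
          (log_one_add_one_div_mul_le hs hτ hapos)
    _ ≤ T.card * Real.log (1 + 1 / (s * τ)) + τ := by
        rw [Finset.sum_add_distrib, Finset.sum_const, nsmul_eq_mul]
        gcongr
        exact sum_posLog_div_le hτ hT

lemma neg_log_one_sub_le {x : ℝ} (hx : x ≤ 1 / 2) (hx0 : 0 ≤ x) :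
    -Real.log (1 - x) ≤ 2 * x := by
  have hinv : (1 - x)⁻¹ ≤ 1 + 2 * x := by
    rw [inv_le_iff_one_le_mul₀ (by linarith)]
    nlinarith
  linarith [Real.one_sub_inv_le_log_of_pos (by linarith : 0 < 1 - x)]

lemma sum_Ico_succ_logEulerFactor_le {s : ℝ} (hs : 0 < s) {N : ℕ}
    (hN : Real.exp (-(s * N)) ≤ 1 / 2) (n : ℕ) :
    ∑ a ∈ Finset.Ico (N + 1) (n + 1), logEulerFactor s a ≤ 2 * Real.exp (-(s * N)) / s := by
  have hterm : ∀ i : ℕ, logEulerFactor s (N + 1 + i) ≤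
      2 * Real.exp (-(s * N)) * Real.exp (-(s * (i + 1))) := by
    intro i
    have hexp : Real.exp (-(s * (N + 1 + i : ℕ))) =
        Real.exp (-(s * N)) * Real.exp (-(s * (i + 1))) := by
      rw [← Real.exp_add]
      push_cast
      ring_nf
    have hle : Real.exp (-(s * (i + 1))) ≤ 1 := Real.exp_le_one_iff.2 (neg_nonpos.2 (by positivity))
    rw [mul_assoc, ← hexp]
    refine neg_log_one_sub_le ?_ (Real.exp_pos _).le
    rw [hexp]
    exact (mul_le_of_le_one_right (Real.exp_pos _).le hle).trans hN
  calc ∑ a ∈ Finset.Ico (N + 1) (n + 1), logEulerFactor s a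
      ≤ ∑ i ∈ Finset.range (n + 1 - (N + 1)),
          2 * Real.exp (-(s * N)) * Real.exp (-(s * (i + 1))) := by
        rw [Finset.sum_Ico_eq_sum_range]
        exact Finset.sum_le_sum fun i _ ↦ hterm i
    _ ≤ 2 * Real.exp (-(s * N)) * (1 / (Real.exp s - 1)) :=
        sum_le_hasSum _ (fun _ _ ↦ by positivity) ((hasSum_exp_neg_mul_succ hs).mul_left _)
    _ ≤ 2 * Real.exp (-(s * N)) * (1 / s) :=
        mul_le_mul_of_nonneg_left (one_div_exp_sub_one_le hs) (by positivity)
    _ = 2 * Real.exp (-(s * N)) / s := by rw [mul_one_div]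

lemma restrictedPartitionCount_le_exp_ncard_mul_log {A : Set ℕ} {s τ : ℝ} {N : ℕ} (hs : 0 < s)
    (hτ : 0 < τ) (hN : Real.exp (-(s * N)) ≤ 1 / 2) (n : ℕ) :
    restrictedPartitionCount A n ≤
      Real.exp (s * n + (A ∩ Set.Icc 1 N).ncard * Real.log (1 + 1 / (s * τ)) + τ +
        2 * Real.exp (-(s * N)) / s) := by
  obtain ⟨T, hT⟩ : ∃ T : Finset ℕ, (T : Set ℕ) = A ∩ Set.Icc 1 N :=
    ⟨_, ((Set.finite_Icc 1 N).inter_of_right A).coe_toFinset⟩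
  have hmem : ∀ a ∈ T, 1 ≤ a ∧ a ≤ N := fun a ha ↦ (hT ▸ ha : a ∈ A ∩ Set.Icc 1 N).2
  have hT0 : 0 ∉ T := fun h ↦ absurd (hmem 0 h).1 (by simp)
  have hdisj : Disjoint T (Finset.Ico (N + 1) (n + 1)) := Finset.disjoint_left.2 fun a ha ha' ↦ by
    have := (hmem a ha).2
    have := (Finset.mem_Ico.1 ha').1
    lia
  have hcover : A ∩ Set.Icc 1 n ⊆ (T ∪ Finset.Ico (N + 1) (n + 1) : Finset ℕ) := by
    rw [Finset.coe_union, hT]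
    rintro a ⟨haA, ha1, han⟩
    rcases le_or_gt a N with haN | haN
    · exact .inl ⟨haA, ha1, haN⟩
    · exact .inr (Finset.mem_coe.2 (Finset.mem_Ico.2 ⟨haN, by lia⟩))
  refine (restrictedPartitionCount_le_exp (by simp [hT0]) hcover hs).trans (Real.exp_le_exp.2 ?_)
  rw [Finset.sum_union hdisj, ← hT, Set.ncard_coe_finset]
  linarith [sum_logEulerFactor_le hs hτ hT0, sum_Ico_succ_logEulerFactor_le hs hN n]

lemma restrictedPartitionCount_le_exp_of_ncard_le {A : Set ℕ} {α β : ℝ} {N n : ℕ} (hα : 0 < α)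
    (hα1 : α ≤ 1) (hN : 0 < N) (hA : ((A ∩ Set.Icc 1 N).ncard : ℝ) ≤ β * N)
    (hn : n ≤ α * (N : ℝ) ^ 2) :
    restrictedPartitionCount A n ≤
      Real.exp (((α + β) * (Real.log (1 / α) + 1) + 2 * α) * N) := by
  have hNpos : (0 : ℝ) < N := by exact_mod_cast hN
  have hL : 0 ≤ Real.log (1 / α) := Real.log_nonneg ((one_le_div hα).2 hα1)
  set L := Real.log (1 / α) with hLdef
  obtain ⟨s, hsN⟩ : ∃ s : ℝ, s * N = L + 1 := ⟨(L + 1) / N, div_mul_cancel₀ _ hNpos.ne'⟩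
  have hs : 0 < s := pos_of_mul_pos_left (by linarith) hNpos.le
  have hlinear : s * n ≤ α * (L + 1) * N := by
    calc s * n ≤ s * (α * (N : ℝ) ^ 2) := by gcongr
      _ = α * (L + 1) * N := by rw [← hsN]; ring
  have hlog : Real.log (1 + 1 / (s * (α * N))) ≤ L + 1 := by
    rw [Real.log_le_iff_le_exp (by positivity), Real.exp_add, Real.exp_log (by positivity),
      mul_left_comm, hsN]
    have hinv : 1 / (α * (L + 1)) ≤ 1 / α :=
      one_div_le_one_div_of_le hα (le_mul_of_one_le_right hα.le (by linarith))
    nlinarith [Real.add_one_le_exp 1, (one_le_div hα).2 hα1]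
  have hexp : Real.exp (-(s * N)) ≤ α / 2 := by
    rw [hsN, neg_add', Real.exp_sub, hLdef, one_div, Real.log_inv, neg_neg, Real.exp_log hα]
    gcongr
    linarith [Real.add_one_le_exp 1]
  have htail : 2 * Real.exp (-(s * N)) / s ≤ α * N := by
    have hαs : α ≤ α * (s * N) := le_mul_of_one_le_right hα.le (by linarith)
    rw [div_le_iff₀ hs]
    linarith
  refine (restrictedPartitionCount_le_exp_ncard_mul_log hs (by positivity : 0 < α * N)
    (hexp.trans (by linarith)) n).trans (Real.exp_le_exp.2 ?_)
  have hmain := mul_le_mul hA hlog (Real.log_nonneg (le_add_of_nonneg_right (by positivity)))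
    ((Nat.cast_nonneg _).trans hA)
  linarith

lemma ncard_inter_Icc_div_le_one (A : Set ℕ) (n : ℕ) :
    ((A ∩ Set.Icc 1 n).ncard : ℝ) / n ≤ 1 := by
  have h := Set.ncard_le_ncard (Set.inter_subset_right (s := A)) (Set.finite_Icc 1 n)
  rw [← Finset.coe_Icc, Set.ncard_coe_finset, Nat.card_Icc, Nat.add_sub_cancel] at h
  exact div_le_one_of_le₀ (by exact_mod_cast h) n.cast_nonneg

lemma isCoboundedUnder_ge_ncard_inter_Icc_div (A : Set ℕ) :
    IsCoboundedUnder (· ≥ ·) atTop (fun n : ℕ ↦ ((A ∩ Set.Icc 1 n).ncard : ℝ) / n) :=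
  (isBoundedUnder_of ⟨1, ncard_inter_Icc_div_le_one A⟩).isCoboundedUnder_ge

lemma frequently_ncard_inter_Icc_le {A : Set ℕ} {β : ℝ} (h : lowerDensity A < β) :
    ∃ᶠ N : ℕ in atTop, ((A ∩ Set.Icc 1 N).ncard : ℝ) ≤ β * N := by
  refine ((frequently_lt_of_liminf_lt (isCoboundedUnder_ge_ncard_inter_Icc_div A) h).and_eventually
    (eventually_gt_atTop 0)).mono fun N ⟨hN, hpos⟩ ↦ ?_
  exact ((div_lt_iff₀ (by exact_mod_cast hpos)).1 hN).le

lemma tendsto_sqrt_mul_floor_mul_sq_div {α : ℝ} (hα : 0 < α) :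
    Tendsto (fun N : ℕ ↦ √(α * ⌊α * (N : ℝ) ^ 2⌋₊) / N) atTop (𝓝 α) := by
  have hsq : Tendsto (fun N : ℕ ↦ (N : ℝ) ^ 2) atTop atTop :=
    (tendsto_pow_atTop two_ne_zero).comp tendsto_natCast_atTop_atTop
  have h := (((tendsto_nat_floor_mul_div_atTop hα.le).comp hsq).const_mul α).sqrt
  rw [Real.sqrt_mul_self hα.le] at h
  refine h.congr fun N ↦ ?_
  rw [Function.comp_apply, ← mul_div_assoc, Real.sqrt_div' _ (by positivity),
    Real.sqrt_sq N.cast_nonneg]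

lemma frequently_restrictedPartitionCount_le_exp {A : Set ℕ} {α c : ℝ} (hα : 0 < α) (hα1 : α ≤ 1)
    (hA : lowerDensity A ≤ α) (hc : Real.log (1 / α) + 2 < c) :
    ∃ᶠ n : ℕ in atTop, restrictedPartitionCount A n ≤ Real.exp (2 * c * √(α * n)) := by
  have hexponent : Tendsto (fun β ↦ (α + β) * (Real.log (1 / α) + 1) + 2 * α) (𝓝[>] α)
      (𝓝 ((α + α) * (Real.log (1 / α) + 1) + 2 * α)) :=
    (Continuous.tendsto (by fun_prop) α).mono_left nhdsWithin_le_nhds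
  obtain ⟨β, hβc, hβ⟩ := ((hexponent.eventually_lt_const
    (by nlinarith : _ < 2 * c * α)).and self_mem_nhdsWithin).exists
  have hfloor : Tendsto (fun N : ℕ ↦ ⌊α * (N : ℝ) ^ 2⌋₊) atTop atTop :=
    tendsto_nat_floor_atTop.comp
      (((tendsto_pow_atTop two_ne_zero).comp tendsto_natCast_atTop_atTop).const_mul_atTop hα)
  have hsqrt := ((tendsto_sqrt_mul_floor_mul_sq_div hα).const_mul (2 * c)).eventually_const_lt hβc
  refine hfloor.frequently (((frequently_ncard_inter_Icc_le (hA.trans_lt hβ)).and_eventually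
    (hsqrt.and (eventually_gt_atTop 0))).mono fun N ⟨hcard, hlt, hN⟩ ↦ ?_)
  refine (restrictedPartitionCount_le_exp_of_ncard_le hα hα1 hN hcard
    (Nat.floor_le (by positivity))).trans (Real.exp_le_exp.2 ?_)
  rw [← mul_div_assoc, lt_div_iff₀ (by exact_mod_cast hN)] at hlt
  exact hlt.le

theorem liminfLogRatio_le_of_lowerDensity_le {A : Set ℕ} {α : ℝ} (hα : 0 < α) (hα1 : α ≤ 1)
    (hA : lowerDensity A ≤ α) :
    liminfLogRatio A α ≤ (√6 / Real.pi * (Real.log (1 / α) + 2) : ℝ) := by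
  have hcont : Tendsto (fun c ↦ ((√6 / Real.pi * c : ℝ) : EReal)) (𝓝[>] (Real.log (1 / α) + 2))
      (𝓝 (√6 / Real.pi * (Real.log (1 / α) + 2) : ℝ)) :=
    (Continuous.tendsto (continuous_coe_real_ereal.comp (by fun_prop)) _).mono_left
      nhdsWithin_le_nhds
  refine ge_of_tendsto hcont ?_
  filter_upwards [self_mem_nhdsWithin] with c hc
  exact liminfLogRatio_le_of_frequently hα
    (frequently_restrictedPartitionCount_le_exp hα hα1 hA hc)

/-! ### Partitions into small and large parts -/

/- Each multiset in `T` is completed to a partition of `n` by parts equal to `1`. -/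
lemma card_le_restrictedPartitionCount {A : Set ℕ} (h1 : 1 ∈ A) {n : ℕ} {T : Finset (Multiset ℕ)}
    (hparts : ∀ m ∈ T, ∀ a ∈ m, a ∈ A ∧ 1 < a) (hsum : ∀ m ∈ T, m.sum ≤ n) :
    T.card ≤ restrictedPartitionCount A n := by
  let complete (m : T) : {P : Nat.Partition n // ∀ i ∈ P.parts, i ∈ A} :=
    ⟨⟨m.1 + Multiset.replicate (n - m.1.sum) 1,
      fun {i} hi ↦ (Multiset.mem_add.1 hi).elim (fun hi ↦ one_pos.trans (hparts m m.2 i hi).2)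
        fun hi ↦ (Multiset.eq_of_mem_replicate hi).symm ▸ one_pos,
      by simp [hsum m m.2]⟩,
    fun i hi ↦ (Multiset.mem_add.1 hi).elim (fun hi ↦ (hparts m m.2 i hi).1)
      fun hi ↦ (Multiset.eq_of_mem_replicate hi).symm ▸ h1⟩
  have hfilter : ∀ m : T, (complete m).1.parts.filter (1 < ·) = m.1 := fun m ↦ by
    rw [Multiset.filter_add, Multiset.filter_eq_self.2 fun a ha ↦ (hparts m m.2 a ha).2,
      Multiset.filter_eq_nil.2 fun a ha ↦ (Multiset.eq_of_mem_replicate ha).le.not_gt, add_zero]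
  have hinj : Function.Injective complete := fun m m' h ↦
    Subtype.ext (by rw [← hfilter m, ← hfilter m', h])
  exact (Nat.card_eq_finsetCard T).symm.trans_le (Nat.card_le_card_of_injective complete hinj)

lemma card_Iic_nsmul_val {ι : Type*} [DecidableEq ι] (M : ℕ) (S : Finset ι) :
    (Finset.Iic (M • S.val)).card = (M + 1) ^ S.card := by
  have hcount : ∀ i ∈ S, (M • S.val).count i = M := fun i hi ↦ by
    rw [Multiset.count_nsmul, Multiset.count_eq_one_of_mem S.nodup hi, mul_one]
  have hsub : (M • S.val).toFinset ⊆ S := fun i hi ↦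
    Multiset.mem_of_mem_nsmul (Multiset.mem_toFinset.1 hi)
  rw [Multiset.card_Iic, Finset.prod_subset hsub fun i _ hi ↦ by
      rw [Multiset.count_eq_zero.2 fun h ↦ hi (Multiset.mem_toFinset.2 h), zero_add],
    Finset.prod_congr rfl fun i hi ↦ by rw [hcount i hi], Finset.prod_const]

open scoped Pointwise in
lemma pow_mul_choose_le_restrictedPartitionCount {A : Set ℕ} (h1 : 1 ∈ A) {S₁ S₂ : Finset ℕ}
    (hS : Disjoint S₁ S₂) (hparts : ∀ a ∈ S₁ ∪ S₂, a ∈ A ∧ 1 < a) {M R b n : ℕ}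
    (hb : ∀ a ∈ S₂, a ≤ b) (hn : M * ∑ a ∈ S₁, a + R * b ≤ n) :
    (M + 1) ^ S₁.card * S₂.card.choose R ≤ restrictedPartitionCount A n := by
  set T₁ := Finset.Iic (M • S₁.val)
  set T₂ := (Finset.powersetCard R S₂).map ⟨Finset.val, Finset.val_injective⟩
  have hT₁ : ∀ m ∈ T₁, ∀ a ∈ m, a ∈ S₁ := fun m hm a ha ↦
    Multiset.mem_of_mem_nsmul (Multiset.mem_of_le (Finset.mem_Iic.1 hm) ha)
  have hT₂ : ∀ m ∈ T₂, m.card = R ∧ ∀ a ∈ m, a ∈ S₂ := fun m hm ↦ by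
    obtain ⟨s, hs, rfl⟩ := Finset.mem_map.1 hm
    obtain ⟨hsub, hcard⟩ := Finset.mem_powersetCard.1 hs
    exact ⟨hcard, fun a ha ↦ hsub ha⟩
  have hfilter : ∀ m₁ ∈ T₁, ∀ m₂ ∈ T₂, (m₁ + m₂).filter (· ∈ S₁) = m₁ := fun m₁ h₁ m₂ h₂ ↦ by
    rw [Multiset.filter_add, Multiset.filter_eq_self.2 (hT₁ m₁ h₁), Multiset.filter_eq_nil.2
      fun a ha ↦ Finset.disjoint_right.1 hS ((hT₂ m₂ h₂).2 a ha), add_zero]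
  have hcard : (T₁ + T₂).card = (M + 1) ^ S₁.card * S₂.card.choose R := by
    rw [Finset.card_add_iff.2, card_Iic_nsmul_val, Finset.card_map, Finset.card_powersetCard]
    rintro ⟨m₁, m₂⟩ ⟨h₁, h₂⟩ ⟨m₁', m₂'⟩ ⟨h₁', h₂'⟩ (h : m₁ + m₂ = m₁' + m₂')
    obtain rfl : m₁ = m₁' := by rw [← hfilter m₁ h₁ m₂ h₂, h, hfilter m₁' h₁' m₂' h₂']
    rw [add_left_cancel h]
  rw [← hcard]
  refine card_le_restrictedPartitionCount h1 ?_ ?_ <;> intro m hm <;>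
    obtain ⟨m₁, h₁, m₂, h₂, rfl⟩ := Finset.mem_add.1 hm
  · intro a ha
    exact hparts a (Finset.mem_union.2 ((Multiset.mem_add.1 ha).imp (hT₁ m₁ h₁ a)
      ((hT₂ m₂ h₂).2 a)))
  · have hsum₁ : m₁.sum ≤ M * ∑ a ∈ S₁, a := by
      obtain ⟨d, hd⟩ := Multiset.le_iff_exists_add.1 (Finset.mem_Iic.1 h₁)
      have hsum := congrArg Multiset.sum hd
      rw [Multiset.sum_nsmul, Multiset.sum_add, Finset.sum_val, smul_eq_mul] at hsum
      exact (Nat.le_add_right _ _).trans_eq hsum.symm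
    have hsum₂ := Multiset.sum_le_card_nsmul m₂ b fun a ha ↦ hb a ((hT₂ m₂ h₂).2 a ha)
    rw [(hT₂ m₂ h₂).1, smul_eq_mul] at hsum₂
    rw [Multiset.sum_add]
    lia

lemma add_log_choose_le_log_restrictedPartitionCount {A : Set ℕ} (h1 : 1 ∈ A) {S₁ S₂ : Finset ℕ}
    (hS : Disjoint S₁ S₂) (hparts : ∀ a ∈ S₁ ∪ S₂, a ∈ A ∧ 1 < a) {M R b n : ℕ}
    (hb : ∀ a ∈ S₂, a ≤ b) (hR : R ≤ S₂.card) (hn : M * ∑ a ∈ S₁, a + R * b ≤ n) :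
    S₁.card * Real.log (M + 1) + Real.log (S₂.card.choose R) ≤
      Real.log (restrictedPartitionCount A n) := by
  have hchoose : (0 : ℝ) < S₂.card.choose R := by exact_mod_cast Nat.choose_pos hR
  rw [← Real.log_pow, ← Real.log_mul (by positivity) hchoose.ne']
  refine Real.log_le_log (by positivity) ?_
  exact_mod_cast pow_mul_choose_le_restrictedPartitionCount h1 hS hparts hb hn

lemma mul_log_le_log_choose {k R : ℕ} (h : R ≤ k) :
    R * Real.log (((k : ℝ) + 1 - R) / R) ≤ Real.log (k.choose R) := by
  rcases R.eq_zero_or_pos with rfl | hR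
  · simp
  have hkR : 0 < (k : ℝ) + 1 - R := by
    have : (R : ℝ) ≤ k := by exact_mod_cast h
    linarith
  rw [← Real.log_pow]
  refine Real.log_le_log (by positivity) ?_
  calc (((k : ℝ) + 1 - R) / R) ^ R = ((k + 1 - R : ℕ) : ℝ) ^ R / (R : ℝ) ^ R := by
        rw [div_pow, Nat.cast_sub (by lia)]
        push_cast
        rfl
    _ ≤ ((k + 1 - R : ℕ) : ℝ) ^ R / R.factorial := by
        gcongr
        exact_mod_cast R.factorial_le_pow
    _ ≤ k.choose R := Nat.pow_le_choose R k

lemma mul_log_div_le_log_choose {k R : ℕ} {x q : ℝ} (hq : 0 < q) (hR : R ≤ q) (hqx : 2 * q ≤ x)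
    (hx : x ≤ k + 1) : R * Real.log (x / (2 * q)) ≤ Real.log (k.choose R) := by
  rcases R.eq_zero_or_pos with rfl | hRpos
  · simp
  have hRk : R ≤ k := by
    have hRk' : (R : ℝ) < k + 1 := by linarith
    exact Nat.lt_add_one_iff.1 (by exact_mod_cast hRk')
  have hratio : x / (2 * q) ≤ ((k : ℝ) + 1 - R) / R := by
    calc x / (2 * q) = x / 2 / q := by rw [div_div]
      _ ≤ ((k : ℝ) + 1 - R) / R := by gcongr <;> linarith
  refine le_trans ?_ (mul_log_le_log_choose hRk)
  gcongr
  exact div_pos (by linarith) (by linarith)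

lemma sub_one_sub_le_card_Ioc_floor {x : ℝ} (hx : 0 ≤ x) (y : ℝ) :
    y - 1 - x ≤ (Finset.Ioc ⌊x⌋₊ ⌊y⌋₊).card := by
  have hle : ⌊y⌋₊ ≤ (Finset.Ioc ⌊x⌋₊ ⌊y⌋₊).card + ⌊x⌋₊ := by
    rw [Nat.card_Ioc]
    exact le_tsub_add
  have hle' : (⌊y⌋₊ : ℝ) ≤ (Finset.Ioc ⌊x⌋₊ ⌊y⌋₊).card + ⌊x⌋₊ := by exact_mod_cast hle
  linarith [Nat.sub_one_lt_floor y, Nat.floor_le hx]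

lemma coe_mem_Ioc_of_mem_Ioc_floor {x y : ℝ} (hx : 0 ≤ x) (hy : 0 ≤ y) {a : ℕ}
    (ha : a ∈ Finset.Ioc ⌊x⌋₊ ⌊y⌋₊) : (a : ℝ) ∈ Set.Ioc x y :=
  ⟨(Nat.floor_lt hx).1 (Finset.mem_Ioc.1 ha).1, (Nat.le_floor_iff hy).1 (Finset.mem_Ioc.1 ha).2⟩

lemma exists_small_block {θ x q : ℝ} {n : ℕ} (hθ : 0 < θ) (hx : 1 ≤ θ * x) (hq : 1 ≤ q)
    (hn : q * x ^ 2 ≤ θ * n) :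
    ∃ (S : Finset ℕ) (M : ℕ), (∀ a ∈ S, (a : ℝ) ∈ Set.Ioc (θ * x) x) ∧
      ((M * ∑ a ∈ S, a : ℕ) : ℝ) ≤ θ * n ∧
      (1 - 2 * θ) * x * Real.log q ≤ S.card * Real.log (M + 1) := by
  have hxpos : 0 < x := pos_of_mul_pos_right (by linarith) hθ.le
  set S := Finset.Ioc ⌊θ * x⌋₊ ⌊x⌋₊
  set M := ⌊θ * n / x ^ 2⌋₊
  have hmem : ∀ a ∈ S, (a : ℝ) ∈ Set.Ioc (θ * x) x := fun a ha ↦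
    coe_mem_Ioc_of_mem_Ioc_floor (by positivity) hxpos.le ha
  refine ⟨S, M, hmem, ?_, ?_⟩
  · have hcard : (S.card : ℝ) ≤ x := by
      refine (Nat.cast_le.2 ?_).trans (Nat.floor_le hxpos.le)
      rw [Nat.card_Ioc]
      exact Nat.sub_le _ _
    have hsum : ∑ a ∈ S, (a : ℝ) ≤ S.card * x := by
      simpa using Finset.sum_le_card_nsmul S (fun a : ℕ ↦ (a : ℝ)) x fun a ha ↦ (hmem a ha).2
    push_cast
    calc M * ∑ a ∈ S, (a : ℝ) ≤ θ * n / x ^ 2 * (x * x) := by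
          gcongr
          · exact Nat.floor_le (by positivity)
          · exact hsum.trans (by gcongr)
      _ = θ * n := by field_simp
  · have hcard : (1 - 2 * θ) * x ≤ S.card := by
      linarith [sub_one_sub_le_card_Ioc_floor (by positivity : 0 ≤ θ * x) x]
    have hM : q ≤ M + 1 :=
      ((le_div_iff₀ (by positivity)).2 hn).trans (Nat.lt_floor_add_one _).le
    exact mul_le_mul hcard (Real.log_le_log (by linarith) hM) (Real.log_nonneg hq) (by positivity)

lemma exists_large_block {θ N q : ℝ} {n : ℕ} (hθ : 0 < θ) (hθ1 : θ ≤ 1) (hN : 0 < N)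
    (hn : N ≤ θ * n) (hq : 1 ≤ q) (hnN : q * (2 * n) ≤ θ * N ^ 2) :
    ∃ (S : Finset ℕ) (R b : ℕ), (∀ a ∈ S, (a : ℝ) ∈ Set.Ioc N ((1 + θ) * N)) ∧ (∀ a ∈ S, a ≤ b) ∧
      ((R * b : ℕ) : ℝ) ≤ (1 - θ) * n ∧ R ≤ S.card ∧
      (1 - 3 * θ) * (n / N) * Real.log q ≤ Real.log (S.card.choose R) := by
  have hnpos : (0 : ℝ) < n := pos_of_mul_pos_right (hN.trans_le hn) hθ.le
  set y := (1 + θ) * N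
  have hy : 0 < y := by positivity
  set S := Finset.Ioc ⌊N⌋₊ ⌊y⌋₊
  set R := ⌊(1 - θ) * n / y⌋₊
  have hcard : θ * N - 1 ≤ S.card := by linarith [sub_one_sub_le_card_Ioc_floor hN.le y]
  have hquot : 1 ≤ θ * (n / N) := by rwa [← mul_div_assoc, one_le_div hN]
  have hRle : (R : ℝ) ≤ n / N := (Nat.floor_le (by positivity)).trans <| by
    gcongr
    · nlinarith
    · exact le_mul_of_one_le_left hN.le (by linarith)
  have hRge : (1 - 3 * θ) * (n / N) ≤ R := by
    have hfrac : (1 - 2 * θ) * (n / N) ≤ (1 - θ) * n / y := by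
      rw [mul_div_mul_comm]
      gcongr
      rw [le_div_iff₀ (by positivity)]
      nlinarith
    linarith [Nat.sub_one_lt_floor ((1 - θ) * n / y)]
  have hqN : q * (2 * (n / N)) ≤ θ * N := by
    rw [← mul_div_assoc, ← mul_div_assoc, div_le_iff₀ hN]
    linarith
  have hnNhalf : 2 * (n / N) ≤ θ * N := (le_mul_of_one_le_left (by positivity) hq).trans hqN
  have hRcard : R ≤ S.card := by
    have hRcard' : (R : ℝ) < S.card + 1 := by linarith
    exact Nat.lt_add_one_iff.1 (by exact_mod_cast hRcard')
  refine ⟨S, R, ⌊y⌋₊, fun a ha ↦ coe_mem_Ioc_of_mem_Ioc_floor hN.le hy.le ha,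
    fun a ha ↦ (Finset.mem_Ioc.1 ha).2, ?_, hRcard, ?_⟩
  · push_cast
    calc (R : ℝ) * ⌊y⌋₊ ≤ (1 - θ) * n / y * y := by
          gcongr <;> exact Nat.floor_le (by positivity)
      _ = (1 - θ) * n := by field_simp
  · refine le_trans ?_ (mul_log_div_le_log_choose (by positivity) hRle hnNhalf (by linarith))
    have hlog : Real.log q ≤ Real.log (θ * N / (2 * (n / N))) :=
      Real.log_le_log (by linarith) ((le_div_iff₀ (by positivity)).2 hqN)
    exact mul_le_mul hRge hlog (Real.log_nonneg hq) (by positivity)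

lemma le_log_restrictedPartitionCount_of_small_block {A : Set ℕ} (h1 : 1 ∈ A) {θ x q : ℝ} {n : ℕ}
    (hθ : 0 < θ) (hθ1 : θ ≤ 1) (hx : 1 ≤ θ * x) (hq : 1 ≤ q) (hn : q * x ^ 2 ≤ θ * n)
    (hA : ∀ a : ℕ, (a : ℝ) ∈ Set.Ioc (θ * x) x → a ∈ A) :
    (1 - 2 * θ) * x * Real.log q ≤ Real.log (restrictedPartitionCount A n) := by
  obtain ⟨S, M, hS, hsum, hgain⟩ := exists_small_block hθ hx hq hn
  have hsum' : M * ∑ a ∈ S, a ≤ n := by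
    exact_mod_cast hsum.trans (mul_le_of_le_one_left n.cast_nonneg hθ1)
  have hparts : ∀ a ∈ S ∪ ∅, a ∈ A ∧ 1 < a := fun a ha ↦ by
    rw [Finset.union_empty] at ha
    exact ⟨hA a (hS a ha), by exact_mod_cast hx.trans_lt (hS a ha).1⟩
  have h := add_log_choose_le_log_restrictedPartitionCount h1 (Finset.disjoint_empty_right S)
    hparts (R := 0) (b := 0) (by simp) le_rfl (by simpa using hsum')
  exact hgain.trans (by simpa using h)

lemma le_log_restrictedPartitionCount_of_large_block {A : Set ℕ} (h1 : 1 ∈ A) {θ N q : ℝ} {n : ℕ}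
    (hθ : 0 < θ) (hθ1 : θ ≤ 1) (hN : 1 ≤ N) (hn : N ≤ θ * n) (hq : 1 ≤ q)
    (hnN : q * (2 * n) ≤ θ * N ^ 2)
    (hA : ∀ a : ℕ, (a : ℝ) ∈ Set.Ioc N ((1 + θ) * N) → a ∈ A) :
    (1 - 3 * θ) * (n / N) * Real.log q ≤ Real.log (restrictedPartitionCount A n) := by
  obtain ⟨S, R, b, hS, hb, hsum, hR, hgain⟩ :=
    exists_large_block hθ hθ1 (by linarith) hn hq hnN
  have hsum' : R * b ≤ n := by
    exact_mod_cast hsum.trans (mul_le_of_le_one_left n.cast_nonneg (by linarith))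
  have hparts : ∀ a ∈ ∅ ∪ S, a ∈ A ∧ 1 < a := fun a ha ↦ by
    rw [Finset.empty_union] at ha
    exact ⟨hA a (hS a ha), by exact_mod_cast hN.trans_lt (hS a ha).1⟩
  have h := add_log_choose_le_log_restrictedPartitionCount h1 (Finset.disjoint_empty_left S)
    hparts (M := 0) hb hR (by simpa using hsum')
  exact hgain.trans (by simpa using h)

lemma le_log_restrictedPartitionCount_of_small_block_of_large_block {A : Set ℕ} (h1 : 1 ∈ A)
    {θ x N q : ℝ} {n : ℕ} (hθ : 0 < θ) (hθ1 : θ ≤ 1) (hx : 1 ≤ θ * x) (hxN : x ≤ N)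
    (hn : N ≤ θ * n) (hq : 1 ≤ q) (hnx : q * x ^ 2 ≤ θ * n) (hnN : q * (2 * n) ≤ θ * N ^ 2)
    (hsmall : ∀ a : ℕ, (a : ℝ) ∈ Set.Ioc (θ * x) x → a ∈ A)
    (hlarge : ∀ a : ℕ, (a : ℝ) ∈ Set.Ioc N ((1 + θ) * N) → a ∈ A) :
    (1 - 2 * θ) * x * Real.log q + (1 - 3 * θ) * (n / N) * Real.log q ≤
      Real.log (restrictedPartitionCount A n) := by
  have hx1 : 1 ≤ x := by nlinarith
  have hN1 : 1 ≤ N := hx1.trans hxN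
  obtain ⟨S₁, M, hS₁, hsum₁, hgain₁⟩ := exists_small_block hθ hx hq hnx
  obtain ⟨S₂, R, b, hS₂, hb, hsum₂, hR, hgain₂⟩ :=
    exists_large_block hθ hθ1 (by linarith) hn hq hnN
  have hdisj : Disjoint S₁ S₂ := Finset.disjoint_left.2 fun a ha₁ ha₂ ↦
    ((hS₁ a ha₁).2.trans hxN).not_gt (hS₂ a ha₂).1
  have hsum : M * ∑ a ∈ S₁, a + R * b ≤ n := by
    have hsum' : ((M * ∑ a ∈ S₁, a + R * b : ℕ) : ℝ) ≤ n := by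
      rw [Nat.cast_add]
      linarith
    exact_mod_cast hsum'
  refine (add_le_add hgain₁ hgain₂).trans
    (add_log_choose_le_log_restrictedPartitionCount h1 hdisj (fun a ha ↦ ?_) hb hR hsum)
  rcases Finset.mem_union.1 ha with ha | ha
  · exact ⟨hsmall a (hS₁ a ha), by exact_mod_cast hx.trans_lt (hS₁ a ha).1⟩
  · exact ⟨hlarge a (hS₂ a ha), by exact_mod_cast hN1.trans_lt (hS₂ a ha).1⟩

/-! ### The factorial block set -/

/-- The extremal set for density `α`: the blocks `(j!, α (j + 1)!]`, together with `1`, which makes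
every `n` a sum of elements of the set. The blocks with `α (j + 1) ≤ 1` are empty. -/
def factorialBlockSet (α : ℝ) : Set ℕ :=
  {a | a = 1 ∨ ∃ j : ℕ, j.factorial < a ∧ (a : ℝ) ≤ α * (j + 1).factorial}

lemma one_mem_factorialBlockSet (α : ℝ) : 1 ∈ factorialBlockSet α := .inl rfl

lemma pos_of_mem_factorialBlockSet {α : ℝ} {a : ℕ} (ha : a ∈ factorialBlockSet α) : 0 < a := by
  rcases ha with rfl | ⟨j, hj, -⟩ <;> lia

lemma mem_factorialBlockSet_of_coe_mem_Ioc {α x y : ℝ} {j a : ℕ} (hx : j.factorial ≤ x)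
    (hy : y ≤ α * (j + 1).factorial) (ha : (a : ℝ) ∈ Set.Ioc x y) : a ∈ factorialBlockSet α :=
  .inr ⟨j, by exact_mod_cast hx.trans_lt ha.1, ha.2.trans hy⟩

lemma ncard_factorialBlockSet_inter_Icc_factorial_le {α : ℝ} (hα : 0 ≤ α) (j : ℕ) :
    ((factorialBlockSet α ∩ Set.Icc 1 j.factorial).ncard : ℝ) ≤ α * j.factorial + 1 := by
  have hsub : factorialBlockSet α ∩ Set.Icc 1 j.factorial ⊆
      (insert 1 (Finset.Icc 1 ⌊α * j.factorial⌋₊) : Finset ℕ) := by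
    rintro a ⟨rfl | ⟨i, hia, hai⟩, ha1, haj⟩
    · simp
    · have hij : i + 1 ≤ j :=
        Nat.lt_of_not_ge fun h ↦ (hia.trans_le haj).not_ge (Nat.factorial_le h)
      have hle : (a : ℝ) ≤ α * j.factorial := hai.trans (by gcongr)
      simp [ha1, Nat.le_floor hle]
  have hcard := (Set.ncard_le_ncard hsub (Finset.finite_toSet _)).trans_eq (Set.ncard_coe_finset _)
  have hcard' := hcard.trans (Finset.card_insert_le _ _)
  rw [Nat.card_Icc, Nat.add_sub_cancel] at hcard'
  calc ((factorialBlockSet α ∩ Set.Icc 1 j.factorial).ncard : ℝ) ≤ ⌊α * j.factorial⌋₊ + 1 := by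
        exact_mod_cast hcard'
    _ ≤ α * j.factorial + 1 := by
        gcongr
        exact Nat.floor_le (by positivity)

lemma card_le_ncard_inter_Icc {A : Set ℕ} {n : ℕ} {S : Finset ℕ}
    (hS : ∀ a ∈ S, a ∈ A ∧ 1 ≤ a ∧ a ≤ n) : S.card ≤ (A ∩ Set.Icc 1 n).ncard := by
  rw [← Set.ncard_coe_finset]
  exact Set.ncard_le_ncard hS ((Set.finite_Icc 1 n).inter_of_right A)

lemma sub_le_ncard_factorialBlockSet_inter_Icc {α : ℝ} (hα : 0 ≤ α) {j n : ℕ}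
    (hn : α * (j + 1).factorial ≤ n) :
    α * (j + 1).factorial - 1 - j.factorial ≤ ((factorialBlockSet α ∩ Set.Icc 1 n).ncard : ℝ) := by
  refine (sub_one_sub_le_card_Ioc_floor (Nat.cast_nonneg _) _).trans
    (Nat.cast_le.2 (card_le_ncard_inter_Icc fun a ha ↦ ?_))
  have ha' := coe_mem_Ioc_of_mem_Ioc_floor (Nat.cast_nonneg _) (by positivity) ha
  have hmem := mem_factorialBlockSet_of_coe_mem_Ioc le_rfl le_rfl ha'
  exact ⟨hmem, pos_of_mem_factorialBlockSet hmem, by exact_mod_cast ha'.2.trans hn⟩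

lemma mul_sub_le_ncard_factorialBlockSet_inter_Icc {α : ℝ} (hα : 0 ≤ α) (hα1 : α ≤ 1) {j n : ℕ}
    (hjn : (j + 1).factorial ≤ n) (hn : n ≤ α * (j + 2).factorial) :
    α * n - 2 - j.factorial ≤ ((factorialBlockSet α ∩ Set.Icc 1 n).ncard : ℝ) := by
  have hjn' : ((j + 1).factorial : ℝ) ≤ n := by exact_mod_cast hjn
  have hαj : α * (j + 1).factorial ≤ (j + 1).factorial := mul_le_of_le_one_left (by positivity) hα1
  set S₁ := Finset.Ioc ⌊(j.factorial : ℝ)⌋₊ ⌊α * (j + 1).factorial⌋₊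
  set S₂ := Finset.Ioc ⌊((j + 1).factorial : ℝ)⌋₊ ⌊(n : ℝ)⌋₊
  have hS₁ : ∀ a ∈ S₁, (a : ℝ) ∈ Set.Ioc (j.factorial : ℝ) (α * (j + 1).factorial) := fun a ha ↦
    coe_mem_Ioc_of_mem_Ioc_floor (Nat.cast_nonneg _) (by positivity) ha
  have hS₂ : ∀ a ∈ S₂, (a : ℝ) ∈ Set.Ioc ((j + 1).factorial : ℝ) n := fun a ha ↦
    coe_mem_Ioc_of_mem_Ioc_floor (Nat.cast_nonneg _) (Nat.cast_nonneg _) ha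
  have hdisj : Disjoint S₁ S₂ := Finset.disjoint_left.2 fun a ha₁ ha₂ ↦
    ((hS₁ a ha₁).2.trans hαj).not_gt (hS₂ a ha₂).1
  have hcard : (S₁ ∪ S₂).card ≤ (factorialBlockSet α ∩ Set.Icc 1 n).ncard := by
    refine card_le_ncard_inter_Icc fun a ha ↦ ?_
    obtain ⟨hmem, han⟩ : a ∈ factorialBlockSet α ∧ (a : ℝ) ≤ n :=
      (Finset.mem_union.1 ha).elim
        (fun ha ↦ ⟨mem_factorialBlockSet_of_coe_mem_Ioc le_rfl le_rfl (hS₁ a ha),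
          (hS₁ a ha).2.trans (hαj.trans hjn')⟩)
        fun ha ↦ ⟨mem_factorialBlockSet_of_coe_mem_Ioc le_rfl hn (hS₂ a ha), (hS₂ a ha).2⟩
    exact ⟨hmem, pos_of_mem_factorialBlockSet hmem, by exact_mod_cast han⟩
  have hcard₁ : α * (j + 1).factorial - 1 - j.factorial ≤ S₁.card :=
    sub_one_sub_le_card_Ioc_floor (Nat.cast_nonneg _) _
  have hcard₂ : (n : ℝ) - 1 - (j + 1).factorial ≤ S₂.card :=
    sub_one_sub_le_card_Ioc_floor (Nat.cast_nonneg _) _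
  have hrest : α * (n - (j + 1).factorial) ≤ n - (j + 1).factorial :=
    mul_le_of_le_one_left (sub_nonneg.2 hjn') hα1
  rw [Finset.card_union_of_disjoint hdisj] at hcard
  have hcard' : (S₁.card : ℝ) + S₂.card ≤ (factorialBlockSet α ∩ Set.Icc 1 n).ncard := by
    exact_mod_cast hcard
  linarith

lemma mul_sub_div_le_ncard_factorialBlockSet_inter_Icc {α : ℝ} (hα : 0 < α) (hα1 : α ≤ 1)
    {j n : ℕ} (hjn : (j + 1).factorial ≤ n) (hn : n ≤ (j + 2).factorial) :
    α * n - 2 - n / (α * (j + 1)) ≤ ((factorialBlockSet α ∩ Set.Icc 1 n).ncard : ℝ) := by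
  have hjn' : ((j + 1).factorial : ℝ) ≤ n := by exact_mod_cast hjn
  have hn' : (n : ℝ) ≤ (j + 2).factorial := by exact_mod_cast hn
  have hfac₁ : ((j + 1).factorial : ℝ) = (j + 1) * j.factorial := by
    exact_mod_cast j.factorial_succ
  have hfac₂ : ((j + 2).factorial : ℝ) = (j + 2) * (j + 1).factorial := by
    exact_mod_cast (j + 1).factorial_succ
  rcases le_or_gt (n : ℝ) (α * (j + 2).factorial) with h | h
  · have hj : (j.factorial : ℝ) ≤ n / (α * (j + 1)) := by
      rw [le_div_iff₀ (by positivity)]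
      nlinarith
    linarith [mul_sub_le_ncard_factorialBlockSet_inter_Icc hα.le hα1 hjn h]
  · have hj : ((j + 1).factorial : ℝ) ≤ n / (α * (j + 1)) := by
      rw [le_div_iff₀ (by positivity)]
      have : 0 ≤ α * (j + 1).factorial := by positivity
      nlinarith
    have hαn : α * n ≤ α * (j + 2).factorial := by gcongr
    linarith [sub_le_ncard_factorialBlockSet_inter_Icc hα.le h.le]

lemma exists_factorial_le_lt {J : ℕ} {x : ℝ} (hJ : J.factorial ≤ x) :
    ∃ j, J ≤ j ∧ j.factorial ≤ x ∧ x < (j + 1).factorial := by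
  let P : ℕ → Prop := fun j ↦ (j.factorial : ℝ) ≤ x
  have hbound : ∀ j, P j → j ≤ ⌊x⌋₊ := fun j hj ↦
    j.self_le_factorial.trans (Nat.le_floor hj)
  classical
  refine ⟨Nat.findGreatest P ⌊x⌋₊, Nat.le_findGreatest (hbound J hJ) hJ,
    Nat.findGreatest_spec (P := P) (hbound J hJ) hJ, ?_⟩
  by_contra! h
  exact Nat.findGreatest_is_greatest (P := P) (Nat.lt_succ_self _) (hbound _ h) h

lemma lowerDensity_factorialBlockSet_le {α : ℝ} (hα : 0 ≤ α) :
    lowerDensity (factorialBlockSet α) ≤ α := by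
  have hfac : Tendsto Nat.factorial atTop atTop :=
    tendsto_atTop_mono Nat.self_le_factorial tendsto_id
  have hbdd : IsBoundedUnder (· ≥ ·) atTop
      fun n : ℕ ↦ ((factorialBlockSet α ∩ Set.Icc 1 n).ncard : ℝ) / n :=
    isBoundedUnder_of ⟨0, fun n ↦ by positivity⟩
  refine le_of_forall_pos_le_add fun δ hδ ↦
    liminf_le_of_frequently_le (hfac.frequently (Eventually.frequently ?_)) hbdd
  filter_upwards [((tendsto_one_div_atTop_nhds_zero_nat (𝕜 := ℝ)).comp hfac).eventually_le_const hδ]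
    with j hj
  have hpos : (0 : ℝ) < j.factorial := by positivity
  rw [Function.comp_apply, div_le_iff₀ hpos] at hj
  rw [div_le_iff₀ hpos]
  linarith [ncard_factorialBlockSet_inter_Icc_factorial_le hα j]

lemma le_lowerDensity_factorialBlockSet {α : ℝ} (hα : 0 < α) (hα1 : α ≤ 1) :
    α ≤ lowerDensity (factorialBlockSet α) := by
  refine le_of_forall_pos_sub_le fun δ hδ ↦
    le_liminf_of_le (isCoboundedUnder_ge_ncard_inter_Icc_div _) ?_
  obtain ⟨J, hJ⟩ := exists_nat_ge (2 / (δ * α))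
  filter_upwards [eventually_ge_atTop (J + 1).factorial,
    tendsto_natCast_atTop_atTop.eventually_ge_atTop (4 / δ)] with n hJn hδn
  obtain ⟨j, hj, hjn, hnj⟩ := exists_factorial_le_lt (J := J + 1) (x := n) (by exact_mod_cast hJn)
  obtain ⟨i, rfl⟩ : ∃ i, j = i + 1 := ⟨j - 1, by lia⟩
  have hcount := mul_sub_div_le_ncard_factorialBlockSet_inter_Icc hα hα1
    (by exact_mod_cast hjn) (by exact_mod_cast hnj.le)
  have hnpos : (0 : ℝ) < n := (by positivity : 0 < 4 / δ).trans_le hδn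
  have hJi : (J : ℝ) ≤ i := by exact_mod_cast (by lia : J ≤ i)
  have herror : n / (α * (i + 1)) ≤ δ / 2 * n := by
    rw [div_le_iff₀ (by positivity)] at hJ ⊢
    have hi : 2 ≤ (i + 1) * (δ * α) :=
      hJ.trans (mul_le_mul_of_nonneg_right (by linarith) (by positivity))
    nlinarith
  rw [div_le_iff₀ hδ] at hδn
  rw [le_div_iff₀ hnpos]
  linarith

lemma lowerDensity_factorialBlockSet {α : ℝ} (hα : 0 < α) (hα1 : α ≤ 1) :
    lowerDensity (factorialBlockSet α) = α :=
  (lowerDensity_factorialBlockSet_le hα.le).antisymm (le_lowerDensity_factorialBlockSet hα hα1)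

lemma mul_factorial_le_mul_factorial_succ {c d : ℝ} {j : ℕ} (h : c ≤ d * (j + 1)) :
    c * j.factorial ≤ d * (j + 1).factorial := by
  rw [j.factorial_succ, Nat.cast_mul, Nat.cast_succ, ← mul_assoc]
  gcongr

lemma two_mul_mul_le_mul_add_mul_sq_div {α N : ℝ} (hα : 0 ≤ α) (hN : 0 < N) (X : ℝ) :
    2 * (α * X) ≤ α * N + α * X ^ 2 / N := by
  rw [← sub_nonneg]
  calc 0 ≤ α * (N - X) ^ 2 / N := by positivity
    _ = α * N + α * X ^ 2 / N - 2 * (α * X) := by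
        field_simp
        ring

lemma le_log_restrictedPartitionCount_factorialBlockSet_of_factorial_near {α θ X : ℝ} {n j : ℕ}
    (hα : 0 < α) (hαθ : 8 * α ≤ θ) (hθ1 : θ ≤ 1 / 3) (hn : n = α * X ^ 2) (hX : 2 ≤ θ * (α * X))
    (hj : 1 ≤ j * (θ * α)) (hXj : X / 2 ≤ j.factorial) (hjX : j.factorial ≤ 2 * X) :
    (1 - 3 * θ) * (2 * (α * X)) * Real.log (θ / (8 * α)) ≤
      Real.log (restrictedPartitionCount (factorialBlockSet α) n) := by
  have hθ : 0 < θ := by linarith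
  have hXpos : 0 < X := pos_of_mul_pos_right (pos_of_mul_pos_right (by linarith) hθ.le) hα.le
  have hq : 1 ≤ θ / (8 * α) := (one_le_div (by positivity)).2 hαθ
  obtain ⟨i, rfl⟩ : ∃ i, j = i + 1 :=
    Nat.exists_eq_succ_of_ne_zero (by rintro rfl; norm_num at hj)
  set N : ℝ := ((i + 1).factorial : ℝ)
  have hNpos : 0 < N := by positivity
  have hsmall : (i.factorial : ℝ) ≤ θ * (α * N) := by
    have hfac := mul_factorial_le_mul_factorial_succ (c := 1) (d := θ * α) (j := i)
      (by push_cast at hj; linarith)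
    linarith
  have hlarge : (1 + θ) * N ≤ α * (i + 1 + 1).factorial :=
    mul_factorial_le_mul_factorial_succ (by nlinarith)
  have hNn : N ≤ θ * n := by
    rw [hn]
    nlinarith
  have hgain := le_log_restrictedPartitionCount_of_small_block_of_large_block
    (one_mem_factorialBlockSet α) (x := α * N) (N := N) (n := n) hθ (by linarith)
    (by nlinarith [mul_le_mul_of_nonneg_left hXj (by positivity : 0 ≤ θ * α)])
    (mul_le_of_le_one_left hNpos.le (by linarith)) hNn hq
    (by rw [hn]; field_simp; nlinarith) (by rw [hn]; field_simp; nlinarith)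
    (fun a ↦ mem_factorialBlockSet_of_coe_mem_Ioc hsmall le_rfl)
    (fun a ↦ mem_factorialBlockSet_of_coe_mem_Ioc le_rfl hlarge)
  have hamgm : 2 * (α * X) ≤ α * N + n / N := hn ▸ two_mul_mul_le_mul_add_mul_sq_div hα.le hNpos X
  have hlog : 0 ≤ Real.log (θ / (8 * α)) := Real.log_nonneg hq
  calc (1 - 3 * θ) * (2 * (α * X)) * Real.log (θ / (8 * α))
      ≤ (1 - 3 * θ) * (α * N + n / N) * Real.log (θ / (8 * α)) := by
        gcongr
        linarith
    _ ≤ (1 - 2 * θ) * (α * N) * Real.log (θ / (8 * α)) +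
          (1 - 3 * θ) * (n / N) * Real.log (θ / (8 * α)) := by
        rw [mul_add, add_mul]
        gcongr
        norm_num
    _ ≤ _ := hgain

lemma le_log_restrictedPartitionCount_factorialBlockSet_of_factorial_far {α θ X : ℝ} {n j : ℕ}
    (hα : 0 < α) (hαθ : 8 * α ≤ θ) (hθ1 : θ ≤ 1 / 3) (hn : n = α * X ^ 2) (hX : 2 ≤ θ * (α * X))
    (hj : 1 ≤ j * (θ * α ^ 2)) (hjX : j.factorial ≤ X / 2) (hXj : 2 * X ≤ (j + 1).factorial) :
    (1 - 3 * θ) * (2 * (α * X)) * Real.log (θ / (8 * α)) ≤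
      Real.log (restrictedPartitionCount (factorialBlockSet α) n) := by
  have hθ : 0 < θ := by linarith
  have hXpos : 0 < X := pos_of_mul_pos_right (pos_of_mul_pos_right (by linarith) hθ.le) hα.le
  have hq : 1 ≤ θ / (8 * α) := (one_le_div (by positivity)).2 hαθ
  rcases le_or_gt ((1 + θ) * (X / 2)) (α * (j + 1).factorial) with hlarge | hlarge
  · have hgain := le_log_restrictedPartitionCount_of_large_block (one_mem_factorialBlockSet α)
      (N := X / 2) (n := n) hθ (by linarith) (by nlinarith) (by rw [hn]; nlinarith) hq
      (by rw [hn]; field_simp; norm_num)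
      (fun a ↦ mem_factorialBlockSet_of_coe_mem_Ioc hjX hlarge)
    have hnX : (n : ℝ) / (X / 2) = 2 * (α * X) := by
      rw [hn]
      field_simp
    rwa [hnX] at hgain
  · have hsmall : (j.factorial : ℝ) ≤ θ * (2 * (α * X)) := by
      have hfac := mul_factorial_le_mul_factorial_succ (c := (1 + θ) / (4 * (θ * α))) (d := α)
        (j := j) (by rw [div_le_iff₀ (by positivity)]; nlinarith)
      have hlt := hfac.trans_lt hlarge
      rw [div_mul_eq_mul_div, div_lt_iff₀ (by positivity)] at hlt
      nlinarith
    have hgain := le_log_restrictedPartitionCount_of_small_block (one_mem_factorialBlockSet α)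
      (x := 2 * (α * X)) (n := n) hθ (by linarith) (by linarith) hq
      (by rw [hn]; field_simp; norm_num)
      (fun a ↦ mem_factorialBlockSet_of_coe_mem_Ioc hsmall (by nlinarith))
    refine le_trans ?_ hgain
    have hlog : 0 ≤ Real.log (θ / (8 * α)) := Real.log_nonneg hq
    gcongr
    norm_num

lemma eventually_exp_le_restrictedPartitionCount_factorialBlockSet {α θ : ℝ} (hα : 0 < α)
    (hαθ : 8 * α ≤ θ) (hθ1 : θ ≤ 1 / 3) :
    ∀ᶠ n : ℕ in atTop, Real.exp (2 * ((1 - 3 * θ) * Real.log (θ / (8 * α))) * √(α * n)) ≤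
      restrictedPartitionCount (factorialBlockSet α) n := by
  have hθ : 0 < θ := by linarith
  obtain ⟨J, hJ⟩ := exists_nat_ge (1 / (θ * α ^ 2))
  have hsqrt : Tendsto (fun n : ℕ ↦ √(n / α)) atTop atTop :=
    Real.tendsto_sqrt_atTop.comp (tendsto_natCast_atTop_atTop.atTop_div_const hα)
  filter_upwards [hsqrt.eventually_ge_atTop (2 / (θ * α)),
    hsqrt.eventually_ge_atTop (J.factorial / 2)] with n hX hXJ
  set X := √(n / α)
  have hn : (n : ℝ) = α * X ^ 2 := by
    rw [Real.sq_sqrt (by positivity)]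
    field_simp
  have hαX : √(α * n) = α * X := by
    rw [hn, ← mul_assoc, ← sq, ← mul_pow, Real.sqrt_sq (by positivity)]
  rw [div_le_iff₀ (by positivity)] at hX hJ
  obtain ⟨j, hJj, hjX, hXj⟩ := exists_factorial_le_lt (J := J) (x := 2 * X) (by linarith)
  have hj : 1 ≤ j * (θ * α ^ 2) := hJ.trans (by gcongr)
  rw [← Real.le_log_iff_exp_le
    (by exact_mod_cast one_le_restrictedPartitionCount (one_mem_factorialBlockSet α) n), hαX,
    show 2 * ((1 - 3 * θ) * Real.log (θ / (8 * α))) * (α * X) =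
      (1 - 3 * θ) * (2 * (α * X)) * Real.log (θ / (8 * α)) by ring]
  rcases le_total (X / 2) j.factorial with h | h
  · refine le_log_restrictedPartitionCount_factorialBlockSet_of_factorial_near hα hαθ hθ1 hn
      (by linarith) (hj.trans ?_) h hjX
    gcongr
    nlinarith
  · exact le_log_restrictedPartitionCount_factorialBlockSet_of_factorial_far hα hαθ hθ1 hn
      (by linarith) hj h hXj.le

lemma eight_le_exp_three : 8 ≤ Real.exp 3 := by
  have h2 : 2 ≤ Real.exp 1 := by linarith [Real.add_one_le_exp 1]
  calc (8 : ℝ) = 2 ^ 3 := by norm_num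
    _ ≤ Real.exp 1 ^ 3 := by gcongr
    _ = Real.exp 3 := by rw [← Real.exp_nat_mul]; norm_num

lemma one_sub_mul_log_ge {L : ℝ} (hL : 2 ≤ L) :
    L - Real.log (L + 1) - 6 ≤
      (1 - 3 * (1 / (L + 1))) * Real.log (1 / (L + 1) / (8 * Real.exp (-L))) := by
  have hlog8 : Real.log 8 ≤ 3 := (Real.log_le_iff_le_exp (by norm_num)).2 eight_le_exp_three
  have hlog : Real.log (1 / (L + 1) / (8 * Real.exp (-L))) = L - Real.log (L + 1) - Real.log 8 := by
    rw [Real.log_div (by positivity) (by positivity), Real.log_mul (by positivity) (by positivity),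
      Real.log_exp, one_div, Real.log_inv]
    ring
  have hpos : 0 ≤ Real.log (L + 1) := Real.log_nonneg (by linarith)
  have hquot : 3 * (1 / (L + 1)) * (L - Real.log (L + 1) - Real.log 8) ≤ 3 := by
    have h8 : 0 ≤ Real.log 8 := Real.log_nonneg (by norm_num)
    rw [mul_one_div, div_mul_eq_mul_div, div_le_iff₀ (by positivity)]
    linarith
  rw [hlog]
  linarith

theorem le_liminfLogRatio_factorialBlockSet {α : ℝ} (hα : 0 < α) (hα1 : α ≤ 1) :
    (√6 / Real.pi * (Real.log (1 / α) - Real.log (Real.log (1 / α) + 1) - 6) : ℝ) ≤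
      liminfLogRatio (factorialBlockSet α) α := by
  set L := Real.log (1 / α) with hL
  have hL0 : 0 ≤ L := Real.log_nonneg (one_le_one_div hα hα1)
  have hαL : Real.exp (-L) = α := by
    rw [hL, one_div, Real.log_inv, neg_neg, Real.exp_log hα]
  refine le_liminfLogRatio_of_eventually hα ?_
  rcases le_or_gt (L - Real.log (L + 1) - 6) 0 with hneg | hpos
  · refine .of_forall fun n ↦ (Real.exp_le_one_iff.2 ?_).trans
      (by exact_mod_cast one_le_restrictedPartitionCount (one_mem_factorialBlockSet α) n)
    exact mul_nonpos_of_nonpos_of_nonneg (by linarith) (Real.sqrt_nonneg _)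
  · have hL6 : 6 ≤ L := by linarith [Real.log_nonneg (by linarith : 1 ≤ L + 1)]
    have hθ : 1 / (L + 1) ≤ 1 / 3 := one_div_le_one_div_of_le (by norm_num) (by linarith)
    have hαθ : 8 * α ≤ 1 / (L + 1) := by
      rw [le_div_iff₀ (by linarith)]
      calc 8 * α * (L + 1) ≤ Real.exp 3 * Real.exp (-L) * Real.exp (Real.log (L + 1)) := by
            rw [hαL, Real.exp_log (by linarith)]
            gcongr
            exact eight_le_exp_three
        _ ≤ 1 := by
            rw [← Real.exp_add, ← Real.exp_add, Real.exp_le_one_iff]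
            linarith
    have hbound := one_sub_mul_log_ge (by linarith : 2 ≤ L)
    rw [hαL] at hbound
    filter_upwards [eventually_exp_le_restrictedPartitionCount_factorialBlockSet hα hαθ hθ]
      with n hn
    exact (Real.exp_le_exp.2 (by gcongr)).trans hn

lemma tendsto_log_one_div_nhdsGT_zero :
    Tendsto (fun α : ℝ ↦ Real.log (1 / α)) (𝓝[>] 0) atTop := by
  simpa only [one_div, Function.comp_def] using
    Real.tendsto_log_atTop.comp tendsto_inv_nhdsGT_zero

lemma tendsto_log_log_one_div_add_six_div :
    Tendsto (fun α : ℝ ↦ (Real.log (Real.log (1 / α) + 1) + 6) / Real.log (1 / α)) (𝓝[>] 0)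
      (𝓝 0) := by
  have hL : Tendsto (fun L : ℝ ↦ (Real.log (L + 1) + 6) / L) atTop (𝓝 0) := by
    have hlog := (Real.tendsto_pow_log_div_mul_add_atTop 1 (-1) 1 one_ne_zero).comp
      (tendsto_atTop_add_const_right atTop 1 tendsto_id)
    simpa [Function.comp_def, add_div] using hlog.add (tendsto_id.const_div_atTop 6)
  exact hL.comp tendsto_log_one_div_nhdsGT_zero

theorem theorem2 :
    (∃ ε : ℝ → ℝ, Tendsto ε (𝓝[>] 0) (𝓝 0) ∧
      ∀ α : ℝ, 0 < α → α < 1 →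
        ∃ A : Set ℕ, (∀ a ∈ A, 0 < a) ∧ Nat.setGcd A = 1 ∧ lowerDensity A = α ∧
          (((1 - ε α) * (√6 / Real.pi) * Real.log (1 / α) : ℝ) : EReal) ≤ liminfLogRatio A α) ∧
    (∃ ε : ℝ → ℝ, Tendsto ε (𝓝[>] 0) (𝓝 0) ∧
      ∀ α : ℝ, 0 < α → α < 1 →
        ∀ A : Set ℕ, (∀ a ∈ A, 0 < a) → lowerDensity A = α →
          liminfLogRatio A α ≤ (((1 + ε α) * (√6 / Real.pi) * Real.log (1 / α) : ℝ) : EReal)) := by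
  refine ⟨⟨fun α ↦ (Real.log (Real.log (1 / α) + 1) + 6) / Real.log (1 / α),
    tendsto_log_log_one_div_add_six_div, fun α hα hα1 ↦
    ⟨factorialBlockSet α, fun _ ↦ pos_of_mem_factorialBlockSet,
      Nat.dvd_one.1 (Nat.setGcd_dvd_of_mem (one_mem_factorialBlockSet α)),
      lowerDensity_factorialBlockSet hα hα1.le, ?_⟩⟩,
    ⟨fun α ↦ 2 / Real.log (1 / α), tendsto_log_one_div_nhdsGT_zero.const_div_atTop 2,
      fun α hα hα1 A _ hA ↦ ?_⟩⟩
  · have hL : 0 < Real.log (1 / α) := Real.log_pos (one_lt_one_div hα hα1)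
    convert le_liminfLogRatio_factorialBlockSet hα hα1.le using 2
    field_simp
    ring
  · have hL : 0 < Real.log (1 / α) := Real.log_pos (one_lt_one_div hα hα1)
    convert liminfLogRatio_le_of_lowerDensity_le hα hα1.le hA.le using 2
    field_simp
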